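/- Let $\mathcal X$ be a standard Borel space and $\mathcal H$ a separable real reproducing kernel Hilbert space of functions on $\mathcal X$ with measurable kernel $K$ and $\sup_x K(x,x)\le\kappa^2$, $\kappa>0$. For a probability measure $\rho$ on $\mathcal X\times\mathbb R$ with $\mathcal X$-marginal $\nu$ and regression function $f_\rho\in\mathcal H$ (that is, $\mathbb E[Y\mid X]=f_\rho(X)$ a.s.), and for a sample $\mathbf z=((x_j,y_j))_{j=1}^n$ drawn from $\rho^{\otimes n}$, put $$\bar B f=\kappa^{-2}\int f(x)K(x,\cdot)\,d\nu(x),\qquad \bar B_{\mathbf x}f=\frac{\kappa^{-2}}{n}\sum_{j=1}^n f(x_j)K(x_j,\cdot),$$ $$\mathcal N(\lambda)=\operatorname{tr}\big((\bar B+\lambda)^{-1}\bar B\big),\qquad \mathcal N_{\mathbf x}(\lambda)=\operatorname{tr}\big((\bar B_{\mathbf x}+\lambda)^{-1}\bar B_{\mathbf x}\big).$$ Let $\sigma,M\ge 0$, $C\in\mathbb R$, $C_s>0$ be constants, let $\mathcal A:(0,\infty)\to\mathbb R$ be increasing with $\lim_{\lambda\to0}\mathcal A(\lambda)=0$, and set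 $$\tilde{\mathcal S}(n,\lambda)=\sigma\sqrt{\frac{\max(\mathcal N(\lambda),1)}{n\lambda}}+\frac{M}{n\lambda},\qquad \tilde{\mathcal S}_{\mathbf x}(n,\lambda)=\sigma\sqrt{\frac{\max(\mathcal N_{\mathbf x}(\lambda),1)}{n\lambda}}+\frac{M}{n\lambda},\qquad \tilde{\mathcal A}(\lambda)=\mathcal A(\lambda)+\frac{C}{\sqrt n}.$$ Let $\Lambda_m=\{\lambda_0<\lambda_1<\dots<\lambda_m\}\subset(0,\infty)$ be a grid with $n\lambda_0\ge 2$, let $s\in[0,\tfrac12]$, and put $C_s(m,\eta)=C_s\log^2(8|\Lambda_m|\eta^{-1})$. For each $\lambda$ let $\mathbf z\mapsto f_{\mathbf z}^\lambda\in\mathcal H$ be an estimator. Let $\mathcal M$ be a class of such distributions $\rho$ and let $\eta\in(0,1]$. Assume that the following error decomposition holds at confidence level $\eta/2$ (for instance because it holds at every level in $(0,1]$): for every $\rho\in\mathcal M$, with $\rho^{\otimes n}$-probability at least $1-\eta/2$, simultaneously for all $\lambda\in\Lambda_m$, $$\big\|(\bar B_{\mathbf x}+\lambda)^s(f_\rho-f_{\mathbf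 z}^\lambda)\big\|_{\mathcal H}\le C_s(m,\eta/2)\,\lambda^s\big(\tilde{\mathcal A}(\lambda)+\tilde{\mathcal S}(n,\lambda)\big).$$ Let $\hat\lambda_s(\mathbf z)$ be the largest $\lambda\in\Lambda_m$ such that for all $\lambda'\in\Lambda_m$ with $\lambda'\le\lambda$ $$\big\|(\bar B_{\mathbf x}+\lambda')^s(f_{\mathbf z}^{\lambda}-f_{\mathbf z}^{\lambda'})\big\|_{\mathcal H}\le 20\,C_s(m,\eta/2)\,\lambda'^s\,\tilde{\mathcal S}_{\mathbf x}(n,\lambda').$$ Then, for every $\rho\in\mathcal M$ such that the set $\{\lambda\in\Lambda_m:\tilde{\mathcal A}(\lambda)\le\tilde{\mathcal S}(n,\lambda)\}$ is non-empty, with maximum $\lambda_*$, and such that $$\eta\ \ge\ \eta_n:=\min\Big(1,\ 4|\Lambda_m|\exp\big(-\tfrac12\sqrt{\mathcal N(\lambda_0)}\big)\Big),$$ one has with $\rho^{\otimes n}$-probability at least $1-\eta$ $$\big\|(\bar B_{\mathbf x}+\lambda_*)^s\big(f_{\mathbf z}^{\hat\lambda_s(\mathbf z)}-f_\rho\big)\big\|_{\mathcal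 H}\ \le\ 102\,C_s(m,\eta/2)\,\lambda_*^s\,\tilde{\mathcal S}(n,\lambda_*).$$ -/

import Mathlib

open MeasureTheory ProbabilityTheory Filter Topology

namespace LepskiiBalancing

noncomputable section

section Operators

variable {H : Type*} [NormedAddCommGroup H] [InnerProductSpace ℝ H] [CompleteSpace H]

/-- The trace `∑ ⟪e i, T e i⟫` of an operator on a Hilbert space, computed in a Hilbert basis.
For trace class operators (the only ones it is applied to) the value does not depend on the
basis. -/
def opTrace (T : H →L[ℝ] H) : ℝ :=
  ∑' i, inner ℝ ((exists_hilbertBasis ℝ H).choose_spec.choose i)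
    (T ((exists_hilbertBasis ℝ H).choose_spec.choose i))

/-- The real power `T ^ s` of a diagonalizable nonnegative self-adjoint operator, applied to `v`:
the sum over the eigenvalues `μ` of `μ ^ s` times the orthogonal projection of `v` onto the
eigenspace of `μ` (the projection vanishes if `μ` is no eigenvalue). It is only applied to
operators `A + lam` with `A` of finite rank, which have finitely many eigenvalues. -/
def opPow (T : H →L[ℝ] H) (s : ℝ) (v : H) : H :=
  ∑' μ : ℝ, (μ ^ s) • (Module.End.eigenspace (T : H →ₗ[ℝ] H) μ).starProjection v

/-- The effective dimension `tr ((A + lam)⁻¹ A)` of a positive operator `A`. -/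
def effDim (A : H →L[ℝ] H) (lam : ℝ) : ℝ :=
  opTrace (Ring.inverse (A + lam • (1 : H →L[ℝ] H)) * A)

end Operators

section RKHS

variable {X : Type*} (H : Type*) [NormedAddCommGroup H] [InnerProductSpace ℝ H]
  [CompleteSpace H] [RKHS ℝ H X ℝ]

/-- The reproducing kernel `K(x, y)` of `H`. -/
def reprKernel (x y : X) : ℝ := RKHS.kernel H x y 1

/-- The kernel section `K(x, ·) ∈ H`. -/
def kerSec (x : X) : H := RKHS.kerFun H x 1

/-- The rank one operator `f ↦ f(x) K(x, ·) = ⟪K(x, ·), f⟫ K(x, ·)`. -/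
def pointOp (x : X) : H →L[ℝ] H := InnerProductSpace.rankOne ℝ (kerSec H x) (kerSec H x)

/-- The normalized kernel integral operator `κ⁻² B`, where `B f = ∫ f(x) K(x, ·) dν(x)`. -/
def covOp [MeasurableSpace X] (κ : ℝ) (ν : Measure X) : H →L[ℝ] H :=
  (κ ^ 2)⁻¹ • ∫ x, pointOp H x ∂ν

/-- The normalized empirical operator `κ⁻² Bₓ`, where `Bₓ f = n⁻¹ ∑ f(xⱼ) K(xⱼ, ·)`. -/
def empOp (κ : ℝ) {n : ℕ} (x : Fin n → X) : H →L[ℝ] H :=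
  (κ ^ 2)⁻¹ • ((n : ℝ)⁻¹ • ∑ j, pointOp H (x j))

variable {H}

/-- `f ∈ H` is a regression function of the law `ρ` of `(X, Y)`: `E[Y | X] = f(X)` a.s. -/
def IsRegressionFunction [MeasurableSpace X] (ρ : Measure (X × ℝ)) (f : H) : Prop :=
  Integrable (fun p : X × ℝ => p.2) ρ ∧
    ρ[fun p : X × ℝ => p.2 | MeasurableSpace.comap Prod.fst inferInstance]
      =ᵐ[ρ] fun p => f p.1

end RKHS

/-- The property `p` holds with probability at least `1 - η`, i.e. it fails with probability
at most `η`. -/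
def HoldsWithProb {Ω : Type*} [MeasurableSpace Ω] (P : Measure Ω) (η : ℝ) (p : Ω → Prop) : Prop :=
  P {ω | ¬ p ω} ≤ ENNReal.ofReal η

/-- The law `ρ^{⊗ n}` of the i.i.d. sample `z = ((x₁, y₁), …, (xₙ, yₙ))`. -/
def sampleLaw {X : Type*} [MeasurableSpace X] (n : ℕ) (ρ : ProbabilityMeasure (X × ℝ)) :
    Measure (Fin n → X × ℝ) :=
  Measure.pi fun _ => (ρ : Measure (X × ℝ))

/-- The marginal `ν` of `ρ` on the input space. -/
def marginal {X : Type*} [MeasurableSpace X] (ρ : ProbabilityMeasure (X × ℝ)) : Measure X :=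
  (ρ : Measure (X × ℝ)).map Prod.fst

/-- The input points `x = (x₁, …, xₙ)` of a sample `z`. -/
def inputs {X : Type*} {n : ℕ} (z : Fin n → X × ℝ) : Fin n → X := fun j => (z j).1

/-- `C_s(m, η) = C_s log² (8 |Λ_m| / η)` for a grid of `m + 1` points. -/
def confConst (Cs : ℝ) (m : ℕ) (η : ℝ) : ℝ := Cs * Real.log (8 * ((m : ℝ) + 1) / η) ^ 2

/-- `σ √(max(N, 1) / (n lam)) + M / (n lam)`: the sample error bound, as a function of the
(population or empirical) effective dimension `N` at `lam`. -/
def sampleTerm (σ M : ℝ) (n : ℕ) (N lam : ℝ) : ℝ :=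
  σ * Real.sqrt (max N 1 / (n * lam)) + M / (n * lam)

/-- The approximation error bound `A(lam) + C / √n`. -/
def approxTerm (A : ℝ → ℝ) (C : ℝ) (n : ℕ) (lam : ℝ) : ℝ := A lam + C / Real.sqrt n

section Main

variable {X : Type*} [MeasurableSpace X] (H : Type*) [NormedAddCommGroup H]
  [InnerProductSpace ℝ H] [CompleteSpace H] [RKHS ℝ H X ℝ]

/-- The population effective dimension `N(lam)` under `ρ`. -/
def popDim (κ : ℝ) (ρ : ProbabilityMeasure (X × ℝ)) (lam : ℝ) : ℝ :=
  effDim (covOp H κ (marginal ρ)) lam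

/-- The sample error bound under `ρ`. -/
def popSample (κ σ M : ℝ) (n : ℕ) (ρ : ProbabilityMeasure (X × ℝ)) (lam : ℝ) : ℝ :=
  sampleTerm σ M n (popDim H κ ρ lam) lam

/-- The empirical sample error bound. -/
def empSample (κ σ M : ℝ) {n : ℕ} (x : Fin n → X) (lam : ℝ) : ℝ :=
  sampleTerm σ M n (effDim (empOp H κ x) lam) lam

/-- The grid points at which the approximation term is dominated by the sample term. -/
def goodGrid (κ σ M C : ℝ) (A : ℝ → ℝ) (n : ℕ) {m : ℕ} (grid : Fin (m + 1) → ℝ)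
    (ρ : ProbabilityMeasure (X × ℝ)) : Set ℝ :=
  {lam | lam ∈ Set.range grid ∧ approxTerm A C n lam ≤ popSample H κ σ M n ρ lam}

/-- `η_n = min (1, 4 |Λ_m| exp (-√N(lam₀) / 2))`, with `lam₀` the smallest grid point. -/
def etaMin (κ : ℝ) {m : ℕ} (grid : Fin (m + 1) → ℝ) (ρ : ProbabilityMeasure (X × ℝ)) : ℝ :=
  min 1 (4 * ((m : ℝ) + 1) * Real.exp (-(1 / 2) * Real.sqrt (popDim H κ ρ (grid 0))))

variable {H}

/-- The norm `‖(κ⁻² Bₓ + lam)^s f‖` in `H`. -/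
def empNorm (κ s lam : ℝ) {n : ℕ} (x : Fin n → X) (f : H) : ℝ :=
  ‖opPow (empOp H κ x + lam • (1 : H →L[ℝ] H)) s f‖

/-- The set of grid points admissible for the balancing principle at confidence level `η`. -/
def balancingSet (κ σ M Cs s η : ℝ) {n m : ℕ} (grid : Fin (m + 1) → ℝ)
    (est : ℝ → (Fin n → X × ℝ) → H) (z : Fin n → X × ℝ) : Set ℝ :=
  {lam | lam ∈ Set.range grid ∧ ∀ lam' ∈ Set.range grid, lam' ≤ lam →
    empNorm κ s lam' (inputs z) (est lam z - est lam' z)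
      ≤ 20 * confConst Cs m (η / 2) * lam' ^ s * empSample H κ σ M (inputs z) lam'}

/-- The balancing estimate, i.e. the largest admissible grid point. The set is finite, and it
contains the smallest grid point, so that the supremum is a maximum. -/
def lamHat (κ σ M Cs s η : ℝ) {n m : ℕ} (grid : Fin (m + 1) → ℝ)
    (est : ℝ → (Fin n → X × ℝ) → H) (z : Fin n → X × ℝ) : ℝ :=
  sSup (balancingSet κ σ M Cs s η grid est z)

/-- The error decomposition at confidence level `η`, uniformly over the grid and over the class
`models` of data generating distributions. Here `est lam z` is the estimator computed from the
sample `z`, and `freg ρ` is the regression function of `ρ`. -/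
structure ErrorDecomposition (models : Set (ProbabilityMeasure (X × ℝ)))
    (freg : ProbabilityMeasure (X × ℝ) → H) {n m : ℕ} (est : ℝ → (Fin n → X × ℝ) → H)
    (grid : Fin (m + 1) → ℝ) (κ σ M C Cs s : ℝ) (A : ℝ → ℝ) (η : ℝ) : Prop where
  grid_pos : 0 < grid 0
  grid_strictMono : StrictMono grid
  s_mem : s ∈ Set.Icc (0 : ℝ) (1 / 2)
  Cs_pos : 0 < Cs
  sigma_nonneg : 0 ≤ σ
  M_nonneg : 0 ≤ M
  A_mono : MonotoneOn A (Set.Ioi 0)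
  A_tendsto : Tendsto A (𝓝[>] 0) (𝓝 0)
  bound : ∀ ρ ∈ models, HoldsWithProb (sampleLaw n ρ) η fun z =>
    ∀ lam ∈ Set.range grid,
      empNorm κ s lam (inputs z) (freg ρ - est lam z)
        ≤ confConst Cs m η * lam ^ s * (approxTerm A C n lam + popSample H κ σ M n ρ lam)

end Main

end

end LepskiiBalancing

open LepskiiBalancing

namespace LepskiiBalancing

noncomputable section

/-! The argument is deterministic on one good event: the error decomposition holds, and the
population and empirical sample terms agree up to a factor 5 at every grid point. For `lam ≤
lamStar` the approximation term is dominated by the sample term, so each estimator has error at most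
`2 c lam^s S(lam)`. Since `lam^s S(lam)` decreases and the norms increase with `lam`, the triangle
inequality bounds `est lamStar - est lam` by `4 c lam^s S(lam)`, hence by 20 times the empirical
term. So `lamStar` is admissible and `lamHat ≥ lamStar`; testing `lamHat` against `lamStar` gives
`20 * 5 + 2 = 102` (`empNorm_lamHat_le`).

The probabilistic part compares `tr ((A + lam)⁻¹ A)` for the empirical and the population operator
up to a factor 25 (`measure_not_comparable_le`). Everything rests on the variational formula `⟨e, (A
+ lam)⁻¹ e⟩ = sup_v (2⟨e, v⟩ - ⟨v, A v⟩ - lam ‖v‖²)`, which yields monotonicity in `lam` and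
concavity in `A`. By concavity at the population operator, the empirical dimension is at most the
population one plus a sum of bounded i.i.d. leverages, and Chernoff's bound gives the upper tail
(`measure_le_effDim_featureOp`). For the lower tail the observations are added one by one: each rank
one update raises the dimension by a multiple of its leverage, whose mean is at least proportional
to the missing dimension. This drift produces an exponential supermartingale
(`lintegral_exp_featureOp_le`). A union bound over the grid finishes the proof. -/

lemma inner_self_nonneg_of_isPositive {H : Type*} [NormedAddCommGroup H] [InnerProductSpace ℝ H]
    {A : H →L[ℝ] H} (hA : A.IsPositive) (v : H) : 0 ≤ inner ℝ v (A v) := by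
  simpa using hA.inner_nonneg_right v

/-! ### Quadratic forms of the resolvent -/

section Resolvent

variable {H : Type*} [NormedAddCommGroup H] [InnerProductSpace ℝ H] [CompleteSpace H]

/-- The resolvent `(A + lam)⁻¹`. -/
def resolv (A : H →L[ℝ] H) (lam : ℝ) : H →L[ℝ] H :=
  Ring.inverse (A + lam • (1 : H →L[ℝ] H))

variable {A B : H →L[ℝ] H} {lam : ℝ}

/-- Coercivity, `⟨(A + lam) v, v⟩ ≥ lam ‖v‖²`. It makes `Ring.inverse` a true inverse instead of its
default value 0. -/
lemma isUnit_add_smul_one (hA : A.IsPositive) (hl : 0 < lam) :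
    IsUnit (A + lam • (1 : H →L[ℝ] H)) := by
  refine ContinuousLinearMap.isUnit_of_forall_le_norm_inner_map _ (c := ⟨lam, hl.le⟩) hl
    fun v => ?_
  have h1 : inner ℝ ((A + lam • (1 : H →L[ℝ] H)) v) v = inner ℝ v (A v) + lam * ‖v‖ ^ 2 := by
    simp [inner_add_left, real_inner_comm, inner_smul_left]
  rw [h1, Real.norm_of_nonneg (by have := inner_self_nonneg_of_isPositive hA v; positivity)]
  have := inner_self_nonneg_of_isPositive hA v
  change ‖v‖ ^ 2 * lam ≤ _
  nlinarith

lemma apply_resolv (hA : A.IsPositive) (hl : 0 < lam) (v : H) :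
    A (resolv A lam v) + lam • resolv A lam v = v := by
  have := congrArg (fun T : H →L[ℝ] H => T v)
    (Ring.mul_inverse_cancel _ (isUnit_add_smul_one hA hl))
  simpa [resolv] using this

lemma resolv_apply (hA : A.IsPositive) (hl : 0 < lam) (v : H) :
    resolv A lam (A v) + lam • resolv A lam v = v := by
  have := congrArg (fun T : H →L[ℝ] H => T v)
    (Ring.inverse_mul_cancel _ (isUnit_add_smul_one hA hl))
  simpa [resolv] using this

lemma inner_resolv_comm (hA : A.IsPositive) (hl : 0 < lam) (v w : H) :
    inner ℝ (resolv A lam v) w = inner ℝ v (resolv A lam w) := by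
  conv_lhs => rw [← apply_resolv hA hl w]
  conv_rhs => rw [← apply_resolv hA hl v]
  have := hA.isSymmetric (resolv A lam v) (resolv A lam w)
  simp only [ContinuousLinearMap.coe_coe] at this
  simp [inner_add_left, inner_add_right, inner_smul_left, inner_smul_right, this]

/-- The quadratic form of the resolvent at its maximizer. -/
lemma inner_resolv_self (hA : A.IsPositive) (hl : 0 < lam) (v : H) :
    inner ℝ v (resolv A lam v) =
      inner ℝ (resolv A lam v) (A (resolv A lam v)) + lam * ‖resolv A lam v‖ ^ 2 := by
  have h := congrArg (fun w => inner ℝ (resolv A lam v) w) (apply_resolv hA hl v)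
  simp only [inner_add_right, inner_smul_right, real_inner_self_eq_norm_sq] at h
  rw [h, real_inner_comm]

/-- The variational principle for the quadratic form of the resolvent. -/
lemma le_inner_resolv (hA : A.IsPositive) (hl : 0 < lam) (e v : H) :
    2 * inner ℝ e v - inner ℝ v (A v) - lam * ‖v‖ ^ 2 ≤ inner ℝ e (resolv A lam e) := by
  set w := resolv A lam e with hw
  have h1 := inner_resolv_self hA hl e
  have h2 := inner_self_nonneg_of_isPositive hA (v - w)
  have h3 : inner ℝ e v = inner ℝ v (A w) + lam * inner ℝ v w := by
    conv_lhs => rw [← apply_resolv hA hl e, real_inner_comm]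
    rw [inner_add_right, inner_smul_right]
  have h4 : inner ℝ w (A v) = inner ℝ v (A w) := by
    have := hA.isSymmetric w v
    simp only [ContinuousLinearMap.coe_coe] at this
    rw [← this, real_inner_comm]
  have h5 : 0 ≤ ‖v - w‖ ^ 2 := by positivity
  rw [norm_sub_sq_real] at h5
  rw [map_sub, inner_sub_left, inner_sub_right, inner_sub_right, h4] at h2
  rw [← hw] at h1
  nlinarith

lemma lam_mul_norm_sq_resolv_le (hA : A.IsPositive) (hl : 0 < lam) (v : H) :
    lam * ‖resolv A lam v‖ ^ 2 ≤ inner ℝ v (resolv A lam v) := by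
  rw [inner_resolv_self hA hl v]
  linarith [inner_self_nonneg_of_isPositive hA (resolv A lam v)]

lemma lam_mul_norm_resolv_le (hA : A.IsPositive) (hl : 0 < lam) (v : H) :
    lam * ‖resolv A lam v‖ ≤ ‖v‖ := by
  have h1 := lam_mul_norm_sq_resolv_le hA hl v
  have h2 := real_inner_le_norm v (resolv A lam v)
  rcases (norm_nonneg (resolv A lam v)).eq_or_lt with h | h
  · rw [← h]; simp
  · refine le_of_mul_le_mul_right ?_ h
    nlinarith

lemma lam_mul_inner_resolv_le (hA : A.IsPositive) (hl : 0 < lam) (v : H) :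
    lam * inner ℝ v (resolv A lam v) ≤ ‖v‖ ^ 2 := by
  have h1 := lam_mul_norm_resolv_le hA hl v
  have h2 := real_inner_le_norm v (resolv A lam v)
  nlinarith [norm_nonneg v]

lemma inner_resolv_nonneg (hA : A.IsPositive) (hl : 0 < lam) (v : H) :
    0 ≤ inner ℝ v (resolv A lam v) :=
  le_trans (by positivity) (lam_mul_norm_sq_resolv_le hA hl v)

/-- The quadratic form of `(A + lam)⁻¹ A`. -/
def dimForm (A : H →L[ℝ] H) (lam : ℝ) (e : H) : ℝ := ‖e‖ ^ 2 - lam * inner ℝ e (resolv A lam e)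

lemma inner_resolv_mul_self (hA : A.IsPositive) (hl : 0 < lam) (e : H) :
    inner ℝ e ((resolv A lam * A) e) = dimForm A lam e := by
  have h := congrArg (fun v => inner ℝ e v) (resolv_apply hA hl e)
  simp only [inner_add_right, inner_smul_right, real_inner_self_eq_norm_sq] at h
  simp only [dimForm, mul_apply_eq_comp]
  linarith

lemma dimForm_nonneg (hA : A.IsPositive) (hl : 0 < lam) (e : H) : 0 ≤ dimForm A lam e := by
  rw [dimForm]; linarith [lam_mul_inner_resolv_le hA hl e]

/-- The variational principle at the test vector `lam⁻¹ e`. This is the domination by `A` that makes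
the effective dimension finite for trace class operators. -/
lemma lam_mul_dimForm_le (hA : A.IsPositive) (hl : 0 < lam) (e : H) :
    lam * dimForm A lam e ≤ inner ℝ e (A e) := by
  have h := le_inner_resolv hA hl e (lam⁻¹ • e)
  simp only [inner_smul_left, inner_smul_right, map_smul, norm_smul, norm_inv, Real.norm_eq_abs,
    abs_of_pos hl, real_inner_self_eq_norm_sq, conj_trivial] at h
  have h2 := mul_le_mul_of_nonneg_left h (sq_nonneg lam)
  have h3 : lam ^ 2 * (2 * (lam⁻¹ * ‖e‖ ^ 2) - lam⁻¹ * (lam⁻¹ * inner ℝ e (A e))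
      - lam * (lam⁻¹ * ‖e‖) ^ 2) = lam * ‖e‖ ^ 2 - inner ℝ e (A e) := by
    field_simp; ring
  rw [dimForm]
  nlinarith

/-- `lam ↦ tr ((A + lam)⁻¹ A)` is decreasing, at the level of quadratic forms. -/
lemma dimForm_anti (hA : A.IsPositive) {lam' : ℝ} (hl : 0 < lam) (hll : lam ≤ lam') (e : H) :
    dimForm A lam' e ≤ dimForm A lam e := by
  have hl' := hl.trans_le hll
  set w := resolv A lam e with hw
  have h1 := inner_resolv_self hA hl e
  have h := le_inner_resolv hA hl' e ((lam / lam') • w)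
  simp only [inner_smul_left, inner_smul_right, map_smul, norm_smul, norm_div, Real.norm_eq_abs,
    abs_of_pos hl, abs_of_pos hl', conj_trivial] at h
  rw [← hw] at h1
  have h2 := mul_le_mul_of_nonneg_left h hl'.le
  have h3 : lam' * (2 * (lam / lam' * inner ℝ e w) - lam / lam' * (lam / lam' * inner ℝ w (A w))
      - lam' * (lam / lam' * ‖w‖) ^ 2) =
      2 * lam * inner ℝ e w - (lam / lam') * (lam * inner ℝ w (A w)) - lam ^ 2 * ‖w‖ ^ 2 := by
    field_simp
  have h4 : (lam / lam') * (lam * inner ℝ w (A w)) ≤ lam * inner ℝ w (A w) :=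
    mul_le_of_le_one_left (mul_nonneg hl.le (inner_self_nonneg_of_isPositive hA w))
      ((div_le_one hl').2 hll)
  rw [dimForm, dimForm, ← hw]
  nlinarith

/-- `lam ↦ lam tr ((A + lam)⁻¹ A)` is increasing, at the level of quadratic forms. -/
lemma mul_dimForm_mono (hA : A.IsPositive) {lam' : ℝ} (hl : 0 < lam) (hll : lam ≤ lam') (e : H) :
    lam * dimForm A lam e ≤ lam' * dimForm A lam' e := by
  have hl' := hl.trans_le hll
  set w := resolv A lam' e with hw
  have h1 := inner_resolv_self hA hl' e
  rw [← hw] at h1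
  have h := le_inner_resolv hA hl e ((lam' / lam) • w)
  simp only [inner_smul_left, inner_smul_right, map_smul, norm_smul, norm_div, Real.norm_eq_abs,
    abs_of_pos hl, abs_of_pos hl', conj_trivial] at h
  have h2 := mul_le_mul_of_nonneg_left h (sq_nonneg lam)
  have h3 : lam ^ 2 * (2 * (lam' / lam * inner ℝ e w)
      - lam' / lam * (lam' / lam * inner ℝ w (A w)) - lam * (lam' / lam * ‖w‖) ^ 2) =
      2 * lam * lam' * inner ℝ e w - lam' ^ 2 * inner ℝ w (A w) - lam * lam' ^ 2 * ‖w‖ ^ 2 := by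
    field_simp
  -- With this test vector the difference of the two sides is at least `(lam' - lam) ‖e - lam' w‖²`.
  have h5 : 0 ≤ ‖e - lam' • w‖ ^ 2 := by positivity
  rw [norm_sub_sq_real, inner_smul_right, norm_smul, Real.norm_eq_abs, abs_of_pos hl'] at h5
  have h6 := mul_nonneg (sub_nonneg.2 hll) h5
  rw [dimForm, dimForm, ← hw]
  nlinarith

/-- The concavity of `A ↦ tr ((A + lam)⁻¹ A)`, at the level of quadratic forms. -/
lemma dimForm_le_add (hA : A.IsPositive) (hB : B.IsPositive) (hl : 0 < lam) (e : H) :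
    dimForm A lam e ≤
      dimForm B lam e + lam * inner ℝ (resolv B lam e) (A (resolv B lam e)) := by
  -- The maximizer for `B` serves as test vector for `A`. The exact tangent at `B` also contains
  -- `-lam ⟨w, B w⟩`, which is dropped by `h1`.
  have h := le_inner_resolv hA hl e (resolv B lam e)
  have h1 := lam_mul_norm_sq_resolv_le hB hl e
  rw [dimForm, dimForm]
  nlinarith

/-- Spectrally, `lam μ / (μ + lam)² ≤ μ / (μ + lam)`; the gap between the two sides is `‖e - lam
w‖²`. -/
lemma lam_mul_inner_resolv_apply_le (hA : A.IsPositive) (hl : 0 < lam) (e : H) :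
    lam * inner ℝ (resolv A lam e) (A (resolv A lam e)) ≤ dimForm A lam e := by
  set w := resolv A lam e with hw
  have h1 := inner_resolv_self hA hl e
  have h2 : 0 ≤ ‖e - lam • w‖ ^ 2 := by positivity
  rw [norm_sub_sq_real, inner_smul_right, norm_smul, Real.norm_eq_abs, abs_of_pos hl] at h2
  rw [← hw] at h1
  rw [dimForm, ← hw]
  nlinarith

/-- A lower bound for the increase of the effective dimension under a rank one update. -/
lemma dimForm_add_rankOne (hA : A.IsPositive) (hl : 0 < lam) (u e : H)
    (hu : 2 * ‖u‖ ^ 2 ≤ lam) :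
    dimForm A lam e + 2 / 3 * (lam * inner ℝ (resolv A lam u) e ^ 2) ≤
      dimForm (A + InnerProductSpace.rankOne ℝ u u) lam e := by
  have hA' := hA.add (InnerProductSpace.isPositive_rankOne_self u)
  set w := resolv (A + InnerProductSpace.rankOne ℝ u u) lam e with hw
  have h1 := apply_resolv hA' hl e
  rw [← hw] at h1
  simp only [_root_.add_apply, InnerProductSpace.rankOne_apply] at h1
  -- The Sherman–Morrison identity, in implicit form.
  have h2 : w = resolv A lam e - inner ℝ u w • resolv A lam u := by
    have h3 := resolv_apply hA hl w
    rw [← map_smul, ← map_add] at h3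
    rw [← map_smul, ← map_sub]
    conv_lhs => rw [← h3]
    congr 1
    rw [eq_sub_iff_add_eq, ← h1]
    abel
  have h3 : inner ℝ u w = inner ℝ (resolv A lam u) e
      - inner ℝ u w * inner ℝ u (resolv A lam u) := by
    conv_lhs => rw [h2]
    rw [inner_sub_right, inner_smul_right, inner_resolv_comm hA hl]
  have h4 : inner ℝ e w = inner ℝ e (resolv A lam e)
      - inner ℝ u w * inner ℝ (resolv A lam u) e := by
    conv_lhs => rw [h2]
    rw [inner_sub_right, inner_smul_right, real_inner_comm e (resolv A lam u)]
  have h5 := inner_resolv_nonneg hA hl u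
  -- The exact gain is `lam t² / (1 + q)`; the smallness of `u` gives `q ≤ 1 / 2`, whence the factor
  -- `2 / 3`.
  have h6 : inner ℝ u (resolv A lam u) ≤ 1 / 2 := by
    have := lam_mul_inner_resolv_le hA hl u
    by_contra! hc
    nlinarith
  rw [dimForm, dimForm, ← hw, h4]
  set c := inner ℝ u w
  set t := inner ℝ (resolv A lam u) e
  set q := inner ℝ u (resolv A lam u)
  have h7 : t = c * (1 + q) := by linarith
  have h8 : 2 / 3 * t ^ 2 ≤ c * t := by
    rw [h7]
    have : 0 ≤ c ^ 2 * (1 + q) * (1 - 2 / 3 * (1 + q)) := by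
      apply mul_nonneg (mul_nonneg (sq_nonneg _) (by linarith)) (by linarith)
    nlinarith
  nlinarith

end Resolvent

/-! ### Effective dimension as a sum over a Hilbert basis -/

section Trace

variable {H : Type*} [NormedAddCommGroup H] [InnerProductSpace ℝ H] [CompleteSpace H]

variable (H) in
/-- The Hilbert basis in which `opTrace` is computed. -/
def traceBasis : HilbertBasis (exists_hilbertBasis ℝ H).choose ℝ H :=
  (exists_hilbertBasis ℝ H).choose_spec.choose

lemma hasSum_inner_traceBasis_sq (u : H) :
    HasSum (fun i => inner ℝ u (traceBasis H i) ^ 2) (‖u‖ ^ 2) := by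
  have h := (traceBasis H).hasSum_inner_mul_inner u u
  rw [real_inner_self_eq_norm_sq] at h
  refine h.congr_fun fun i => ?_
  rw [real_inner_comm u, sq]

/-- Orthonormal vectors lie at distance `√2`, so balls of radius `1 / 2` around them are disjoint.
Countability is needed to exchange basis sums with integrals and for measurability of basis sums. -/
instance countable_traceBasis_index [TopologicalSpace.SeparableSpace H] :
    Countable (exists_hilbertBasis ℝ H).choose := by
  have ho := (traceBasis H).orthonormal
  have hd : Pairwise fun i j => Disjoint (Metric.ball (traceBasis H i) (1 / 2))
      (Metric.ball (traceBasis H j) (1 / 2)) := by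
    intro i j hij
    apply Metric.ball_disjoint_ball
    have h1 : dist (traceBasis H i) (traceBasis H j) ^ 2 = 2 := by
      rw [dist_eq_norm, norm_sub_sq_real, ho.1 i, ho.1 j, ho.2 hij]; norm_num
    by_contra! hc
    nlinarith [dist_nonneg (x := traceBasis H i) (y := traceBasis H j)]
  exact Pairwise.countable_of_isOpen_disjoint hd (fun _ => Metric.isOpen_ball)
    (fun i => ⟨_, Metric.mem_ball_self (by norm_num)⟩)

/-- `A` is a positive operator with finite trace. -/
structure PosTrace (A : H →L[ℝ] H) : Prop where
  pos : A.IsPositive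
  summable : Summable fun i => inner ℝ (traceBasis H i) (A (traceBasis H i))

variable {A B : H →L[ℝ] H} {lam : ℝ}

lemma PosTrace.add (hA : PosTrace A) (hB : PosTrace B) : PosTrace (A + B) :=
  ⟨hA.pos.add hB.pos, by simpa [inner_add_right] using hA.summable.add hB.summable⟩

lemma posTrace_zero : PosTrace (0 : H →L[ℝ] H) :=
  ⟨ContinuousLinearMap.isPositive_zero, by simp⟩

lemma posTrace_rankOne (u : H) : PosTrace (InnerProductSpace.rankOne ℝ u u) :=
  ⟨InnerProductSpace.isPositive_rankOne_self u, by
    refine (hasSum_inner_traceBasis_sq u).summable.congr fun i => ?_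
    rw [InnerProductSpace.inner_right_rankOne_apply, real_inner_comm, sq]⟩

lemma posTrace_sum {ι : Type*} (s : Finset ι) (u : ι → H) :
    PosTrace (∑ j ∈ s, InnerProductSpace.rankOne ℝ (u j) (u j)) := by
  classical
  induction s using Finset.induction_on with
  | empty => simpa using posTrace_zero
  | insert j s hj ih => rw [Finset.sum_insert hj]; exact (posTrace_rankOne _).add ih

lemma effDim_eq_tsum (hA : A.IsPositive) (hl : 0 < lam) :
    effDim A lam = ∑' i, dimForm A lam (traceBasis H i) :=
  tsum_congr fun _ => inner_resolv_mul_self hA hl _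

/-- Excludes the default value 0 of `tsum`, so that inequalities between quadratic forms can be
summed to inequalities between effective dimensions. -/
lemma summable_dimForm (hA : PosTrace A) (hl : 0 < lam) :
    Summable fun i => dimForm A lam (traceBasis H i) := by
  refine Summable.of_nonneg_of_le (fun _ => dimForm_nonneg hA.pos hl _) (fun i => ?_)
    (hA.summable.mul_left lam⁻¹)
  rw [inv_mul_eq_div, le_div_iff₀ hl, mul_comm]
  exact lam_mul_dimForm_le hA.pos hl _

lemma hasSum_dimForm (hA : PosTrace A) (hl : 0 < lam) :
    HasSum (fun i => dimForm A lam (traceBasis H i)) (effDim A lam) := by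
  rw [effDim_eq_tsum hA.pos hl]; exact (summable_dimForm hA hl).hasSum

lemma effDim_zero (lam : ℝ) : effDim (0 : H →L[ℝ] H) lam = 0 := by
  simp [effDim, opTrace]

lemma effDim_nonneg (hA : A.IsPositive) (hl : 0 < lam) : 0 ≤ effDim A lam := by
  rw [effDim_eq_tsum hA hl]; exact tsum_nonneg fun _ => dimForm_nonneg hA hl _

lemma effDim_anti (hA : PosTrace A) {lam' : ℝ} (hl : 0 < lam) (hll : lam ≤ lam') :
    effDim A lam' ≤ effDim A lam :=
  hasSum_le (fun _ => dimForm_anti hA.pos hl hll _) (hasSum_dimForm hA (hl.trans_le hll))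
    (hasSum_dimForm hA hl)

lemma mul_effDim_mono (hA : PosTrace A) {lam' : ℝ} (hl : 0 < lam) (hll : lam ≤ lam') :
    lam * effDim A lam ≤ lam' * effDim A lam' :=
  hasSum_le (fun _ => mul_dimForm_mono hA.pos hl hll _) ((hasSum_dimForm hA hl).mul_left _)
    ((hasSum_dimForm hA (hl.trans_le hll)).mul_left _)

lemma effDim_le_add (hA : PosTrace A) (hB : PosTrace B) (hl : 0 < lam) {a : ℝ}
    (ha : HasSum (fun i => inner ℝ (resolv B lam (traceBasis H i))
      (A (resolv B lam (traceBasis H i)))) a) :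
    effDim A lam ≤ effDim B lam + lam * a :=
  hasSum_le (fun _ => dimForm_le_add hA.pos hB.pos hl _) (hasSum_dimForm hA hl)
    ((hasSum_dimForm hB hl).add (ha.mul_left lam))

lemma mul_hasSum_le_effDim (hA : PosTrace A) (hl : 0 < lam) {a : ℝ}
    (ha : HasSum (fun i => inner ℝ (resolv A lam (traceBasis H i))
      (A (resolv A lam (traceBasis H i)))) a) :
    lam * a ≤ effDim A lam :=
  hasSum_le (fun _ => lam_mul_inner_resolv_apply_le hA.pos hl _) (ha.mul_left lam)
    (hasSum_dimForm hA hl)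

lemma effDim_add_rankOne (hA : PosTrace A) (hl : 0 < lam) (u : H) (hu : 2 * ‖u‖ ^ 2 ≤ lam) :
    effDim A lam + 2 / 3 * (lam * ‖resolv A lam u‖ ^ 2) ≤
      effDim (A + InnerProductSpace.rankOne ℝ u u) lam :=
  hasSum_le (fun _ => dimForm_add_rankOne hA.pos hl u _ hu)
    ((hasSum_dimForm hA hl).add (((hasSum_inner_traceBasis_sq _).mul_left lam).mul_left _))
    (hasSum_dimForm (hA.add (posTrace_rankOne u)) hl)

/-- Move the symmetric resolvent onto each `u j` and apply Parseval. This evaluates the first order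
term of `effDim_le_add` for an empirical operator. -/
lemma hasSum_inner_resolv_sum {ι : Type*} (s : Finset ι) (u : ι → H) (hB : B.IsPositive)
    (hl : 0 < lam) :
    HasSum (fun i => inner ℝ (resolv B lam (traceBasis H i))
      ((∑ j ∈ s, InnerProductSpace.rankOne ℝ (u j) (u j)) (resolv B lam (traceBasis H i))))
      (∑ j ∈ s, ‖resolv B lam (u j)‖ ^ 2) := by
  refine (hasSum_sum fun j _ => hasSum_inner_traceBasis_sq (resolv B lam (u j))).congr_fun
    fun i => ?_
  simp only [_root_.sum_apply, inner_sum]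
  refine Finset.sum_congr rfl fun j _ => ?_
  rw [InnerProductSpace.inner_right_rankOne_apply, inner_resolv_comm hB hl,
    real_inner_comm, inner_resolv_comm hB hl, sq]

end Trace

/-! ### Leverages and empirical feature operators -/

section Features

variable {H : Type*} [NormedAddCommGroup H] [InnerProductSpace ℝ H] {Ω : Type*}

/-- The squared length of the whitened feature `lam (A + lam)⁻¹ φ`. -/
def leverage (A : H →L[ℝ] H) (lam : ℝ) (φ : Ω → H) (ω : Ω) : ℝ :=
  (lam * ‖resolv A lam (φ ω)‖) ^ 2

lemma leverage_nonneg {A : H →L[ℝ] H} {lam : ℝ} {φ : Ω → H} (ω : Ω) : 0 ≤ leverage A lam φ ω := sq_nonneg _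

/-- The operator `∑ⱼ uⱼ ⊗ uⱼ` of the scaled features `uⱼ = c φ(ωⱼ)`. -/
def featureOp (c : ℝ) (φ : Ω → H) {k : ℕ} (ω : Fin k → Ω) : H →L[ℝ] H :=
  ∑ j, InnerProductSpace.rankOne ℝ (c • φ (ω j)) (c • φ (ω j))

lemma featureOp_cons (c : ℝ) (φ : Ω → H) {k : ℕ} (a : Ω) (ω : Fin k → Ω) :
    featureOp c φ (Fin.cons a ω : Fin (k + 1) → Ω) =
      InnerProductSpace.rankOne ℝ (c • φ a) (c • φ a) + featureOp c φ ω := by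
  simp [featureOp, Fin.sum_univ_succ]

lemma posTrace_featureOp [CompleteSpace H] (c : ℝ) (φ : Ω → H) {k : ℕ} (ω : Fin k → Ω) :
    PosTrace (featureOp c φ ω) := posTrace_sum _ _

end Features

/-! ### Exponential tails of the empirical effective dimension -/

section Tails

/-- Chernoff's bound. -/
lemma measure_ge_le_of_lintegral_exp_le {Ω : Type*} [MeasurableSpace Ω] {μ : Measure Ω}
    {f : Ω → ℝ} (hf : Measurable f) {c : ℝ}
    (h : ∫⁻ ω, ENNReal.ofReal (Real.exp (f ω)) ∂μ ≤ ENNReal.ofReal (Real.exp c)) (t : ℝ) :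
    μ {ω | t ≤ f ω} ≤ ENNReal.ofReal (Real.exp (c - t)) := by
  have h1 := mul_meas_ge_le_lintegral (μ := μ)
    (f := fun ω => ENNReal.ofReal (Real.exp (f ω))) (by fun_prop) (ENNReal.ofReal (Real.exp t))
  have h2 : {ω | t ≤ f ω} =
      {ω | ENNReal.ofReal (Real.exp t) ≤ ENNReal.ofReal (Real.exp (f ω))} := by
    ext ω
    simp [ENNReal.ofReal_le_ofReal_iff (Real.exp_pos _).le]
  rw [h2, Real.exp_sub, ENNReal.ofReal_div_of_pos (Real.exp_pos t),
    ENNReal.le_div_iff_mul_le (Or.inl (by simp [Real.exp_pos])) (Or.inl ENNReal.ofReal_ne_top),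
    mul_comm]
  exact h1.trans h

/-- A convex function lies below its chord on `[0, 1]`. -/
lemma exp_neg_mul_le {θ z : ℝ} (hz0 : 0 ≤ z) (hz1 : z ≤ 1) :
    Real.exp (-(θ * z)) ≤ 1 - (1 - Real.exp (-θ)) * z := by
  have h := convexOn_exp.2 (Set.mem_univ (-θ)) (Set.mem_univ 0) hz0 (sub_nonneg.2 hz1) (by ring)
  simp only [smul_eq_mul, mul_zero, add_zero, Real.exp_zero, mul_one] at h
  rw [show -(θ * z) = z * -θ by ring]
  linarith

lemma exp_le_one_add_two_mul {z : ℝ} (hz0 : 0 ≤ z) (hz1 : z ≤ 1) : Real.exp z ≤ 1 + 2 * z := by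
  have h := exp_neg_mul_le (θ := -1) hz0 hz1
  have h3 := Real.exp_one_lt_d9
  simp only [neg_mul, one_mul, neg_neg] at h
  nlinarith

lemma exp_neg_three_halves_le : Real.exp (-(3 / 2)) ≤ 1 / 4 := by
  have h1 : (4 : ℝ) ≤ Real.exp (3 / 2) := by
    have h2 := Real.sum_le_exp_of_nonneg (x := 3 / 2) (by norm_num) 5
    norm_num [Finset.sum_range_succ, Nat.factorial] at h2
    linarith
  rw [Real.exp_neg, inv_le_comm₀ (Real.exp_pos _) (by norm_num)]
  simpa using h1

variable {H : Type*} [NormedAddCommGroup H] [InnerProductSpace ℝ H]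
  {Ω : Type*} [MeasurableSpace Ω]

/-- `T` is the covariance operator of the feature map `φ`, which takes values in the unit ball. -/
structure IsCovariance (μ : Measure Ω) (φ : Ω → H) (T : H →L[ℝ] H) : Prop where
  pos : T.IsPositive
  stronglyMeasurable : StronglyMeasurable φ
  norm_le : ∀ ω, ‖φ ω‖ ≤ 1
  inner_eq : ∀ v, inner ℝ v (T v) = ∫ ω, inner ℝ (φ ω) v ^ 2 ∂μ

variable {μ : Measure Ω} {φ : Ω → H} {T A : H →L[ℝ] H} {lam : ℝ}

lemma leverage_le_one [CompleteSpace H] (hT : IsCovariance μ φ T) (hA : A.IsPositive) (hl : 0 < lam) (ω : Ω) :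
    leverage A lam φ ω ≤ 1 := by
  have h1 := (lam_mul_norm_resolv_le hA hl (φ ω)).trans (hT.norm_le ω)
  rw [leverage, sq_le_one_iff₀ (by positivity)]
  exact h1

lemma measurable_leverage (hT : IsCovariance μ φ T) : Measurable (leverage A lam φ) :=
  ((((resolv A lam).continuous.comp_stronglyMeasurable hT.stronglyMeasurable).norm.const_mul
    lam).pow 2).measurable

lemma integral_leverage : ∫ ω, leverage A lam φ ω ∂μ =
    lam * (lam * ∫ ω, ‖resolv A lam (φ ω)‖ ^ 2 ∂μ) := by
  rw [← integral_const_mul, ← integral_const_mul]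
  congr 1 with ω
  rw [leverage]; ring

variable [CompleteSpace H]

lemma integrable_leverage [IsProbabilityMeasure μ] (hT : IsCovariance μ φ T) (hA : A.IsPositive) (hl : 0 < lam) :
    Integrable (leverage A lam φ) μ :=
  Integrable.of_bound (measurable_leverage hT).aestronglyMeasurable 1
    (Eventually.of_forall fun ω => by
      rw [Real.norm_of_nonneg (leverage_nonneg ω)]; exact leverage_le_one hT hA hl ω)

/-- The population analogue of `hasSum_inner_resolv_sum`: Parseval under the integral sign,
exchanged with the basis sum by domination by `‖S‖²`. It is applied to resolvents, and to the
identity to get the finite trace of `T`. -/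
lemma hasSum_inner_of_symm [TopologicalSpace.SeparableSpace H] [IsProbabilityMeasure μ]
    (hT : IsCovariance μ φ T)
    (S : H →L[ℝ] H) (hS : ∀ v w, inner ℝ (S v) w = inner ℝ v (S w)) :
    HasSum (fun i => inner ℝ (S (traceBasis H i)) (T (S (traceBasis H i))))
      (∫ ω, ‖S (φ ω)‖ ^ 2 ∂μ) := by
  have hm : StronglyMeasurable fun ω => S (φ ω) :=
    S.continuous.comp_stronglyMeasurable hT.stronglyMeasurable
  simp_rw [hT.inner_eq, ← hS]
  have hs : ∀ ω, HasSum (fun i => inner ℝ (S (φ ω)) (traceBasis H i) ^ 2) (‖S (φ ω)‖ ^ 2) :=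
    fun ω => hasSum_inner_traceBasis_sq _
  refine hasSum_integral_of_dominated_convergence
    (fun i ω => inner ℝ (S (φ ω)) (traceBasis H i) ^ 2)
    (fun i => ((hm.inner stronglyMeasurable_const).pow 2).aestronglyMeasurable)
    (fun i => Eventually.of_forall fun ω => by simp)
    (Eventually.of_forall fun ω => (hs ω).summable) ?_ (Eventually.of_forall hs)
  simp_rw [fun ω => (hs ω).tsum_eq]
  refine Integrable.of_bound (hm.norm.pow 2).aestronglyMeasurable (‖S‖ ^ 2)
    (Eventually.of_forall fun ω => ?_)
  rw [Real.norm_of_nonneg (by positivity)]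
  have := S.le_of_opNorm_le le_rfl (φ ω)
  have h1 := hT.norm_le ω
  gcongr
  exact this.trans (mul_le_of_le_one_right (norm_nonneg _) h1)

variable [TopologicalSpace.SeparableSpace H] [IsProbabilityMeasure μ]

lemma IsCovariance.posTrace (hT : IsCovariance μ φ T) : PosTrace T :=
  ⟨hT.pos, by simpa using (hasSum_inner_of_symm hT 1 (by simp)).summable⟩

lemma integral_leverage_le (hT : IsCovariance μ φ T) (hl : 0 < lam) :
    ∫ ω, leverage T lam φ ω ∂μ ≤ lam * effDim T lam := by
  rw [integral_leverage]
  exact mul_le_mul_of_nonneg_left (mul_hasSum_le_effDim hT.posTrace hl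
    (hasSum_inner_of_symm hT _ (inner_resolv_comm hT.pos hl))) hl.le

/-- The drift for the lower tail: by concavity at `A`, a deficit of effective dimension forces a
large mean leverage of the next observation. -/
lemma le_integral_leverage (hT : IsCovariance μ φ T) (hA : PosTrace A) (hl : 0 < lam) :
    lam * (effDim T lam - effDim A lam) ≤ ∫ ω, leverage A lam φ ω ∂μ := by
  rw [integral_leverage]
  refine mul_le_mul_of_nonneg_left ?_ hl.le
  linarith [effDim_le_add hT.posTrace hA hl
    (hasSum_inner_of_symm hT _ (inner_resolv_comm hA.pos hl))]

/-- Inversion is continuous at units, so each basis term is a continuous function of the feature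
vectors, and the sum over the basis is countable. -/
lemma measurable_effDim_featureOp (hφ : StronglyMeasurable φ) (hA : PosTrace A) (hl : 0 < lam)
    (c : ℝ) (k : ℕ) :
    Measurable fun ω : Fin k → Ω => effDim (A + featureOp c φ ω) lam := by
  borelize H
  have : SecondCountableTopology H := UniformSpace.secondCountable_of_separable H
  simp_rw [fun ω : Fin k → Ω => effDim_eq_tsum (hA.add (posTrace_featureOp c φ ω)).pos hl]
  refine Measurable.tsum fun i => ?_
  have hc : Continuous fun v : Fin k → H =>
      dimForm (A + ∑ j, InnerProductSpace.rankOne ℝ (v j) (v j)) lam (traceBasis H i) := by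
    have h1 : Continuous fun v : Fin k → H =>
        resolv (A + ∑ j, InnerProductSpace.rankOne ℝ (v j) (v j)) lam := by
      rw [continuous_iff_continuousAt]
      intro v
      obtain ⟨x, hx⟩ := isUnit_add_smul_one
        (hA.add (posTrace_sum Finset.univ v)).pos hl
      have h2 := NormedRing.inverse_continuousAt x
      rw [hx] at h2
      refine ContinuousAt.comp (f := fun v : Fin k → H =>
        (A + ∑ j, InnerProductSpace.rankOne ℝ (v j) (v j)) + lam • (1 : H →L[ℝ] H)) h2 ?_
      refine Continuous.continuousAt ?_
      have h3 : ∀ j, Continuous fun v : Fin k → H =>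
          InnerProductSpace.rankOne ℝ (v j) (v j) := fun j =>
        ((InnerProductSpace.rankOne ℝ).continuous.comp (continuous_apply j)).clm_apply
          (continuous_apply j)
      exact (continuous_const.add (continuous_finsetSum _ fun j _ => h3 j)).add
        continuous_const
    unfold dimForm
    exact continuous_const.sub (continuous_const.mul
      (continuous_const.inner (h1.clm_apply continuous_const)))
  have hm : Measurable fun (ω : Fin k → Ω) (j : Fin k) => c • φ (ω j) :=
    measurable_pi_lambda _ fun j => (hφ.measurable.comp (measurable_pi_apply j)).const_smul c
  exact hc.measurable.comp hm

/-- One step of the exponential supermartingale for the lower tail. -/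
lemma lintegral_exp_rankOne_le (hT : IsCovariance μ φ T) (hA : PosTrace A) {n : ℕ}
    (hn : 2 ≤ n * lam) (hl : 0 < lam) {t : ℝ} (ht : 3 / 2 * (n * lam) ≤ t) :
    ∫⁻ ω, ENNReal.ofReal (Real.exp (-(t * effDim
        (A + InnerProductSpace.rankOne ℝ ((√n)⁻¹ • φ ω) ((√n)⁻¹ • φ ω)) lam))) ∂μ ≤
      ENNReal.ofReal (Real.exp (-((t - lam / 2) * effDim A lam) - lam / 2 * effDim T lam)) := by
  have hn0 : (0 : ℝ) < n := by
    by_contra! h; nlinarith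
  have hb : 0 < n * lam := by positivity
  have hsq : (√(n : ℝ))⁻¹ ^ 2 = (n : ℝ)⁻¹ := by rw [inv_pow, Real.sq_sqrt hn0.le]
  have hstep : ∀ ω, Real.exp (-(t * effDim
        (A + InnerProductSpace.rankOne ℝ ((√n)⁻¹ • φ ω) ((√n)⁻¹ • φ ω)) lam)) ≤
      Real.exp (-(t * effDim A lam)) * (1 - 1 / 2 * leverage A lam φ ω) := by
    intro ω
    have hu : ‖(√(n : ℝ))⁻¹ • φ ω‖ ^ 2 = (n : ℝ)⁻¹ * ‖φ ω‖ ^ 2 := by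
      rw [norm_smul, mul_pow, Real.norm_eq_abs, sq_abs, hsq]
    have h1 : 2 * ‖(√(n : ℝ))⁻¹ • φ ω‖ ^ 2 ≤ lam := by
      rw [hu]
      have : ‖φ ω‖ ^ 2 ≤ 1 := pow_le_one₀ (norm_nonneg _) (hT.norm_le ω)
      calc 2 * ((n : ℝ)⁻¹ * ‖φ ω‖ ^ 2) ≤ 2 * ((n : ℝ)⁻¹ * 1) := by gcongr
        _ ≤ lam := by
          rw [mul_one, ← div_eq_mul_inv, div_le_iff₀ hn0]; linarith
    have h2 := effDim_add_rankOne hA hl _ h1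
    have h3 : lam * ‖resolv A lam ((√(n : ℝ))⁻¹ • φ ω)‖ ^ 2 =
        leverage A lam φ ω / (n * lam) := by
      rw [map_smul, norm_smul, mul_pow, Real.norm_eq_abs, sq_abs, hsq, leverage]
      field_simp
    rw [h3] at h2
    have hlev0 := leverage_nonneg (A := A) (lam := lam) (φ := φ) ω
    have hlev1 := leverage_le_one hT hA.pos hl ω
    -- The chord bound for `exp (-(3 / 2) Z)` has slope at least `3 / 4`, and `3 / 4 * 2 / 3` is the
    -- coefficient `1 / 2` in `hstep`.
    set Z := 2 / 3 * leverage A lam φ ω with hZ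
    have h4 : 3 / 2 * Z ≤ t * (2 / 3 * (leverage A lam φ ω / (n * lam))) := by
      calc 3 / 2 * Z = 3 / 2 * (n * lam) * (2 / 3 * (leverage A lam φ ω / (n * lam))) := by
            rw [hZ]; field_simp
        _ ≤ _ := by gcongr
    have h5 : t * (effDim A lam + 2 / 3 * (leverage A lam φ ω / (n * lam))) ≤ _ :=
      mul_le_mul_of_nonneg_left h2 (by nlinarith)
    have h6 := exp_neg_mul_le (θ := 3 / 2) (z := Z) (by positivity) (by linarith)
    have h7 := exp_neg_three_halves_le
    calc _ ≤ Real.exp (-(t * effDim A lam) + -(3 / 2 * Z)) := by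
          apply Real.exp_le_exp.2; linarith
      _ = Real.exp (-(t * effDim A lam)) * Real.exp (-(3 / 2 * Z)) := Real.exp_add _ _
      _ ≤ _ := by
          gcongr
          nlinarith
  calc _ ≤ ∫⁻ ω, ENNReal.ofReal
          (Real.exp (-(t * effDim A lam)) * (1 - 1 / 2 * leverage A lam φ ω)) ∂μ :=
        lintegral_mono fun ω => ENNReal.ofReal_le_ofReal (hstep ω)
    _ = ENNReal.ofReal (∫ ω,
          Real.exp (-(t * effDim A lam)) * (1 - 1 / 2 * leverage A lam φ ω) ∂μ) := by
        rw [ofReal_integral_eq_lintegral_ofReal]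
        · exact ((integrable_const _).sub
            ((integrable_leverage hT hA.pos hl).const_mul _)).const_mul _
        · refine Eventually.of_forall fun ω => mul_nonneg (Real.exp_pos _).le ?_
          linarith [leverage_le_one hT hA.pos hl ω]
    _ ≤ _ := by
        apply ENNReal.ofReal_le_ofReal
        rw [integral_const_mul, integral_sub (integrable_const _)
          ((integrable_leverage hT hA.pos hl).const_mul _), integral_const_mul]
        simp only [integral_const, probReal_univ, smul_eq_mul, one_mul]
        have h1 := le_integral_leverage hT hA hl
        have h2 := Real.add_one_le_exp (-(lam / 2 * (effDim T lam - effDim A lam)))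
        rw [show -((t - lam / 2) * effDim A lam) - lam / 2 * effDim T lam =
          -(t * effDim A lam) + -(lam / 2 * (effDim T lam - effDim A lam)) by ring, Real.exp_add]
        gcongr
        linarith

/-- The first observation is absorbed into `A`, which is why the starting operator is arbitrary.
Each observation transfers weight `lam / 2` from `effDim A` to `effDim T`; the condition on `t`
keeps the remaining weight above the `3 / 2 * (n * lam)` required by `lintegral_exp_rankOne_le`. -/
lemma lintegral_exp_featureOp_le (hT : IsCovariance μ φ T) {n : ℕ}
    (hn : 2 ≤ n * lam) (hl : 0 < lam) {t : ℝ} (k : ℕ) :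
    ∀ {A : H →L[ℝ] H}, PosTrace A → 3 / 2 * (n * lam) + k * (lam / 2) ≤ t →
    ∫⁻ ω, ENNReal.ofReal (Real.exp (-(t * effDim (A + featureOp (√n)⁻¹ φ ω) lam)))
        ∂(Measure.pi fun _ : Fin k => μ) ≤
      ENNReal.ofReal (Real.exp (-((t - k * (lam / 2)) * effDim A lam)
        - k * (lam / 2) * effDim T lam)) := by
  induction k with
  | zero =>
    intro A hA ht
    simp [featureOp]
  | succ k ih =>
    intro A hA ht
    push_cast at ht
    have hmeas := measurable_effDim_featureOp hT.stronglyMeasurable hA hl (√(n : ℝ))⁻¹ (k + 1)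
    have hmp := (measurePreserving_piFinSuccAbove (fun _ : Fin (k + 1) => μ) 0).symm
    rw [← hmp.lintegral_comp_emb (MeasurableEquiv.measurableEmbedding _), lintegral_prod]
    · calc _ ≤ ∫⁻ a, ENNReal.ofReal (Real.exp (-((t - k * (lam / 2)) * effDim
            (A + InnerProductSpace.rankOne ℝ ((√n)⁻¹ • φ a) ((√n)⁻¹ • φ a)) lam)
            - k * (lam / 2) * effDim T lam)) ∂μ := by
            refine lintegral_mono fun a => ?_
            refine le_trans (le_of_eq ?_) (ih (hA.add (posTrace_rankOne ((√n)⁻¹ • φ a)))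
              (by linarith))
            refine lintegral_congr fun ω => ?_
            rw [add_assoc, ← featureOp_cons]
            simp only [MeasurableEquiv.piFinSuccAbove_symm_apply, Fin.insertNthEquiv,
              Equiv.coe_fn_mk, Fin.insertNth_zero]
            rfl
        _ = ENNReal.ofReal (Real.exp (-(k * (lam / 2) * effDim T lam))) *
            ∫⁻ a, ENNReal.ofReal (Real.exp (-((t - k * (lam / 2)) * effDim
            (A + InnerProductSpace.rankOne ℝ ((√n)⁻¹ • φ a) ((√n)⁻¹ • φ a)) lam))) ∂μ := by
            rw [← lintegral_const_mul' _ _ ENNReal.ofReal_ne_top]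
            refine lintegral_congr fun a => ?_
            rw [← ENNReal.ofReal_mul (Real.exp_pos _).le, ← Real.exp_add]
            congr 2
            ring
        _ ≤ _ := by
            refine (mul_le_mul_right (lintegral_exp_rankOne_le hT hA hn hl
              (by linarith)) _).trans (le_of_eq ?_)
            rw [← ENNReal.ofReal_mul (Real.exp_pos _).le, ← Real.exp_add]
            congr 2
            push_cast
            ring
    · refine Measurable.aemeasurable ?_
      have : Measurable fun ω : Fin (k + 1) → Ω => ENNReal.ofReal
          (Real.exp (-(t * effDim (A + featureOp (√n)⁻¹ φ ω) lam))) := by fun_prop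
      exact this.comp (MeasurableEquiv.measurable _)

/-- The lower tail of the empirical effective dimension. -/
lemma measure_effDim_featureOp_le (hT : IsCovariance μ φ T) {n : ℕ}
    (hn : 2 ≤ n * lam) (hl : 0 < lam) :
    (Measure.pi fun _ : Fin n => μ)
        {ω | 25 * effDim (featureOp (√n)⁻¹ φ ω) lam ≤ effDim T lam} ≤
      ENNReal.ofReal (Real.exp (-(2 / 5 * (n * lam * effDim T lam)))) := by
  have hm := measurable_effDim_featureOp hT.stronglyMeasurable posTrace_zero hl (√(n : ℝ))⁻¹ n
  -- The smallest admissible weight for `n` steps is `3 / 2 + 1 / 2 = 2` times `n * lam`. Chernoff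
  -- then gives the exponent `-1 / 2 + 2 / 25 = -21 / 50`, below `-2 / 5`.
  have h := lintegral_exp_featureOp_le hT hn hl (t := 2 * (n * lam)) n posTrace_zero
    (by linarith)
  simp only [zero_add] at hm h
  have h1 := measure_ge_le_of_lintegral_exp_le (by fun_prop) h
    (-(2 * (n * lam) * (effDim T lam / 25)))
  have hN := effDim_nonneg hT.pos hl
  refine (measure_mono fun ω hω => ?_).trans (h1.trans (ENNReal.ofReal_le_ofReal
    (Real.exp_le_exp.2 ?_)))
  · simp only [Set.mem_ofPred_eq] at hω ⊢
    nlinarith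
  · rw [effDim_zero lam]
    have : 0 ≤ n * lam * effDim T lam := mul_nonneg (by linarith) hN
    linarith

/-- The upper tail of the empirical effective dimension. -/
lemma measure_le_effDim_featureOp (hT : IsCovariance μ φ T) {n : ℕ}
    (hn : 2 ≤ n * lam) (hl : 0 < lam) :
    (Measure.pi fun _ : Fin n => μ)
        {ω | 25 * max (effDim T lam) 1 ≤ effDim (featureOp (√n)⁻¹ φ ω) lam} ≤
      ENNReal.ofReal (Real.exp (-(22 * (n * lam * max (effDim T lam) 1)))) := by
  have hn0 : (0 : ℝ) < n := by
    by_contra! h; nlinarith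
  have hsq : (√(n : ℝ))⁻¹ ^ 2 = (n : ℝ)⁻¹ := by rw [inv_pow, Real.sq_sqrt hn0.le]
  have hlm := measurable_leverage (A := T) (lam := lam) hT
  have hbound : ∀ ω : Fin n → Ω, n * lam * effDim (featureOp (√n)⁻¹ φ ω) lam ≤
      n * lam * effDim T lam + ∑ j, leverage T lam φ (ω j) := by
    intro ω
    have h1 := effDim_le_add (posTrace_featureOp (√n)⁻¹ φ ω) hT.posTrace hl
      (hasSum_inner_resolv_sum Finset.univ _ hT.pos hl)
    have h2 : n * lam * (lam * ∑ j, ‖resolv T lam ((√(n : ℝ))⁻¹ • φ (ω j))‖ ^ 2) =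
        ∑ j, leverage T lam φ (ω j) := by
      rw [Finset.mul_sum, Finset.mul_sum]
      refine Finset.sum_congr rfl fun j _ => ?_
      rw [map_smul, norm_smul, mul_pow, Real.norm_eq_abs, sq_abs, hsq, leverage]
      field_simp
    rw [← h2, ← mul_add]
    exact mul_le_mul_of_nonneg_left h1 (by linarith)
  have hint : Integrable (fun ω => Real.exp (leverage T lam φ ω)) μ := by
    refine Integrable.of_bound (by fun_prop) (Real.exp 1) (Eventually.of_forall fun ω => ?_)
    rw [Real.norm_of_nonneg (Real.exp_pos _).le]
    exact Real.exp_le_exp.2 (leverage_le_one hT hT.pos hl ω)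
  have hmgf : ∫ ω, Real.exp (leverage T lam φ ω) ∂μ ≤
      Real.exp (2 * (lam * effDim T lam)) := by
    calc _ ≤ ∫ ω, (1 + 2 * leverage T lam φ ω) ∂μ := by
          refine integral_mono hint ((integrable_const _).add
            ((integrable_leverage hT hT.pos hl).const_mul _)) fun ω => ?_
          exact exp_le_one_add_two_mul (leverage_nonneg ω) (leverage_le_one hT hT.pos hl ω)
      _ = 1 + 2 * ∫ ω, leverage T lam φ ω ∂μ := by
          rw [integral_add (integrable_const _)
            ((integrable_leverage hT hT.pos hl).const_mul _), integral_const_mul]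
          simp
      _ ≤ _ := by
          have := Real.add_one_le_exp (2 * (lam * effDim T lam))
          linarith [integral_leverage_le hT hl]
  have hlin : ∫⁻ ω, ENNReal.ofReal (Real.exp (∑ j, leverage T lam φ (ω j)))
      ∂(Measure.pi fun _ : Fin n => μ) ≤
      ENNReal.ofReal (Real.exp (2 * (n * lam * effDim T lam))) := by
    simp_rw [Real.exp_sum]
    rw [← ofReal_integral_eq_lintegral_ofReal
      (Integrable.fintype_prod (f := fun _ ω => Real.exp (leverage T lam φ ω)) fun _ => hint)
      (Eventually.of_forall fun ω => Finset.prod_nonneg fun j _ => (Real.exp_pos _).le)]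
    rw [integral_fintype_prod_eq_prod (fun (_ : Fin n) ω => Real.exp (leverage T lam φ ω))]
    apply ENNReal.ofReal_le_ofReal
    rw [Finset.prod_const, Finset.card_univ, Fintype.card_fin,
      show 2 * (n * lam * effDim T lam) = n * (2 * (lam * effDim T lam)) by ring, Real.exp_nat_mul]
    exact pow_le_pow_left₀ (integral_nonneg fun ω => (Real.exp_pos _).le) hmgf n
  -- On the event the leverages sum to at least `25 - 1 = 24` units of `n * lam * max (effDim T lam)
  -- 1`; their exponential moment costs at most 2 of these, which leaves 22.
  have h1 := measure_ge_le_of_lintegral_exp_le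
    (Finset.measurable_fun_sum _ fun j _ => hlm.comp (measurable_pi_apply j)) hlin
    (24 * (n * lam * max (effDim T lam) 1))
  have hmax : n * lam * effDim T lam ≤ n * lam * max (effDim T lam) 1 :=
    mul_le_mul_of_nonneg_left (le_max_left _ _) (by linarith)
  refine (measure_mono fun ω hω => ?_).trans (h1.trans (ENNReal.ofReal_le_ofReal
    (Real.exp_le_exp.2 ?_)))
  · simp only [Set.mem_ofPred_eq] at hω ⊢
    simp only [Function.comp_apply]
    have h2 := mul_le_mul_of_nonneg_left hω (show 0 ≤ n * lam by linarith)
    linarith [hbound ω]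
  · linarith

end Tails

/-! ### Fractional powers of shifted finite rank operators -/

section Power

variable {H : Type*} [NormedAddCommGroup H] [InnerProductSpace ℝ H]
  {A : H →L[ℝ] H}

lemma finite_hasEigenvalue_of_finiteDimensional_range
    (hA : FiniteDimensional ℝ (LinearMap.range (A : H →ₗ[ℝ] H))) :
    {μ : ℝ | Module.End.HasEigenvalue (A : H →ₗ[ℝ] H) μ}.Finite := by
  set p := LinearMap.range (A : H →ₗ[ℝ] H)
  have hp : ∀ v ∈ p, (A : H →ₗ[ℝ] H) v ∈ p := fun v _ => LinearMap.mem_range_self _ v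
  refine ((Module.End.finite_hasEigenvalue
    ((A : H →ₗ[ℝ] H).restrict hp)).union (Set.finite_singleton 0)).subset fun μ hμ => ?_
  by_cases h0 : μ = 0
  · right; exact h0
  left
  obtain ⟨v, hv⟩ := Module.End.HasEigenvalue.exists_hasEigenvector hμ
  have hAv := hv.apply_eq_smul
  -- Eigenvectors with nonzero eigenvalue lie in the range, where there are only finitely many
  -- eigenvalues.
  have hvp : v ∈ p := ⟨μ⁻¹ • v, by rw [map_smul, hAv, smul_smul, inv_mul_cancel₀ h0, one_smul]⟩
  refine Module.End.hasEigenvalue_of_hasEigenvector (x := ⟨v, hvp⟩)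
    (Module.End.hasEigenvector_iff.2 ⟨Module.End.mem_eigenspace_iff.2 (Subtype.ext ?_), ?_⟩)
  · simpa using hAv
  · intro h
    exact hv.2 (congrArg Subtype.val h)

lemma eigenspace_add_smul_one (lam μ : ℝ) :
    Module.End.eigenspace ((A + lam • (1 : H →L[ℝ] H) : H →L[ℝ] H) : H →ₗ[ℝ] H) (μ + lam) =
      Module.End.eigenspace (A : H →ₗ[ℝ] H) μ := by
  ext v
  simp [add_smul]

lemma finiteDimensional_range_sum {ι : Type*} (t : Finset ι) (u : ι → H) :
    FiniteDimensional ℝ (LinearMap.range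
      ((∑ j ∈ t, InnerProductSpace.rankOne ℝ (u j) (u j) : H →L[ℝ] H) : H →ₗ[ℝ] H)) := by
  have : FiniteDimensional ℝ (Submodule.span ℝ (u '' t)) :=
    FiniteDimensional.span_of_finite ℝ (t.finite_toSet.image u)
  refine Submodule.finiteDimensional_of_le (S₂ := Submodule.span ℝ (u '' t)) ?_
  rintro _ ⟨v, rfl⟩
  simp only [ContinuousLinearMap.coe_coe, _root_.sum_apply, InnerProductSpace.rankOne_apply]
  exact Submodule.sum_mem _ fun j hj => Submodule.smul_mem _ _
    (Submodule.subset_span ⟨j, hj, rfl⟩)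

variable [CompleteSpace H]

/-- `(A + lam)^s v` as a finite sum over the eigenvalues of a finite rank operator `A`. -/
lemma opPow_add_smul_one (hA : FiniteDimensional ℝ (LinearMap.range (A : H →ₗ[ℝ] H)))
    (lam s : ℝ) (v : H) :
    opPow (A + lam • (1 : H →L[ℝ] H)) s v =
      ∑ μ ∈ (finite_hasEigenvalue_of_finiteDimensional_range hA).toFinset,
        ((μ + lam) ^ s) • (Module.End.eigenspace (A : H →ₗ[ℝ] H) μ).starProjection v := by
  rw [opPow, ← (Equiv.addRight lam).tsum_eq]
  simp only [Equiv.coe_addRight, eigenspace_add_smul_one]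
  refine tsum_eq_sum fun μ hμ => ?_
  have h : Module.End.eigenspace (A : H →ₗ[ℝ] H) μ = ⊥ := by
    by_contra h
    exact hμ (by simpa [Module.End.hasEigenvalue_iff] using h)
  simp [h]

lemma opPow_add (hA : FiniteDimensional ℝ (LinearMap.range (A : H →ₗ[ℝ] H)))
    (lam s : ℝ) (v w : H) :
    opPow (A + lam • (1 : H →L[ℝ] H)) s (v + w) =
      opPow (A + lam • (1 : H →L[ℝ] H)) s v + opPow (A + lam • (1 : H →L[ℝ] H)) s w := by
  simp only [opPow_add_smul_one hA, map_add, smul_add, Finset.sum_add_distrib]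

lemma opPow_neg (hA : FiniteDimensional ℝ (LinearMap.range (A : H →ₗ[ℝ] H)))
    (lam s : ℝ) (v : H) :
    opPow (A + lam • (1 : H →L[ℝ] H)) s (-v) = -opPow (A + lam • (1 : H →L[ℝ] H)) s v := by
  simp only [opPow_add_smul_one hA, map_neg, smul_neg, Finset.sum_neg_distrib]

/-- Pythagoras for the mutually orthogonal eigenspaces. Only the weights depend on `lam`, which
reduces `norm_opPow_mono` to a comparison of real powers. -/
lemma norm_opPow_sq (hp : A.IsPositive)
    (hA : FiniteDimensional ℝ (LinearMap.range (A : H →ₗ[ℝ] H))) (lam s : ℝ) (v : H) :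
    ‖opPow (A + lam • (1 : H →L[ℝ] H)) s v‖ ^ 2 =
      ∑ μ ∈ (finite_hasEigenvalue_of_finiteDimensional_range hA).toFinset,
        (|(μ + lam) ^ s| *
          ‖(Module.End.eigenspace (A : H →ₗ[ℝ] H) μ).starProjection v‖) ^ 2 := by
  rw [opPow_add_smul_one hA]
  have h := hp.isSymmetric.orthogonalFamily_eigenspaces.norm_sum
    (fun μ => ((μ + lam) ^ s) •
      (⟨_, Submodule.starProjection_apply_mem (Module.End.eigenspace (A : H →ₗ[ℝ] H) μ) v⟩ :
        Module.End.eigenspace (A : H →ₗ[ℝ] H) μ))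
    (finite_hasEigenvalue_of_finiteDimensional_range hA).toFinset
  refine Eq.trans (congrArg (fun w => ‖w‖ ^ 2) ?_) (h.trans ?_)
  · exact Finset.sum_congr rfl fun μ _ => by simp
  · exact Finset.sum_congr rfl fun μ _ => by rw [norm_smul]; rfl

lemma norm_opPow_mono (hp : A.IsPositive)
    (hA : FiniteDimensional ℝ (LinearMap.range (A : H →ₗ[ℝ] H))) {lam lam' s : ℝ}
    (hl : 0 < lam) (hll : lam ≤ lam') (hs : 0 ≤ s) (v : H) :
    ‖opPow (A + lam • (1 : H →L[ℝ] H)) s v‖ ≤ ‖opPow (A + lam' • (1 : H →L[ℝ] H)) s v‖ := by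
  rw [← sq_le_sq₀ (norm_nonneg _) (norm_nonneg _), norm_opPow_sq hp hA, norm_opPow_sq hp hA]
  refine Finset.sum_le_sum fun μ hμ => ?_
  have hμ0 : 0 ≤ μ := by
    obtain ⟨w, hw⟩ := Module.End.HasEigenvalue.exists_hasEigenvector
      ((Set.Finite.mem_toFinset _).1 hμ)
    have h1 := inner_self_nonneg_of_isPositive hp w
    have h2 : A w = μ • w := hw.apply_eq_smul
    rw [h2, inner_smul_right, real_inner_self_eq_norm_sq] at h1
    have h3 : 0 < ‖w‖ ^ 2 := by have := norm_pos_iff.2 hw.2; positivity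
    exact nonneg_of_mul_nonneg_left h1 h3
  have h0 : 0 ≤ μ + lam := by linarith
  rw [abs_of_nonneg (Real.rpow_nonneg h0 s), abs_of_nonneg (Real.rpow_nonneg (h0.trans
    (by linarith)) s)]
  gcongr

end Power

/-! ### The kernel operators as covariance and feature operators -/

section Kernel

variable {X : Type*} {H : Type*} [NormedAddCommGroup H] [InnerProductSpace ℝ H]
  [CompleteSpace H] [RKHS ℝ H X ℝ]

lemma inner_kerSec (f : H) (x : X) : inner ℝ f (kerSec H x) = f x := by
  simp [kerSec]

lemma norm_kerSec_sq (x : X) : ‖kerSec H x‖ ^ 2 = reprKernel H x x := by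
  rw [← real_inner_self_eq_norm_sq, inner_kerSec, kerSec, RKHS.kerFun_apply, reprKernel]

/-- The normalized feature map `κ⁻¹ K(x, ·)` of an observation `(x, y)`. -/
def feature (H : Type*) [NormedAddCommGroup H] [InnerProductSpace ℝ H] [CompleteSpace H]
    [RKHS ℝ H X ℝ] (κ : ℝ) (p : X × ℝ) : H := κ⁻¹ • kerSec H p.1

lemma norm_kerSec_le {κ : ℝ} (hκ : 0 < κ) (hKκ : ∀ x : X, reprKernel H x x ≤ κ ^ 2) (x : X) :
    ‖kerSec H x‖ ≤ κ := by
  have h := hKκ x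
  rw [← norm_kerSec_sq] at h
  exact (sq_le_sq₀ (norm_nonneg _) hκ.le).1 h

lemma norm_feature_le {κ : ℝ} (hκ : 0 < κ) (hKκ : ∀ x : X, reprKernel H x x ≤ κ ^ 2)
    (p : X × ℝ) : ‖feature H κ p‖ ≤ 1 := by
  rw [feature, norm_smul, norm_inv, Real.norm_eq_abs, abs_of_pos hκ, inv_mul_le_iff₀ hκ, mul_one]
  exact norm_kerSec_le hκ hKκ p.1

lemma empOp_eq_featureOp (κ : ℝ) {n : ℕ} (z : Fin n → X × ℝ) :
    empOp H κ (inputs z) = featureOp (√n)⁻¹ (feature H κ) z := by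
  refine ContinuousLinearMap.ext fun v => ?_
  simp only [empOp, featureOp, pointOp, inputs, feature, _root_.smul_apply, _root_.sum_apply,
    InnerProductSpace.rankOne_apply, Finset.smul_sum, smul_smul, inner_smul_left, conj_trivial]
  refine Finset.sum_congr rfl fun j _ => ?_
  congr 1
  have : (√(n : ℝ))⁻¹ * (√(n : ℝ))⁻¹ = (n : ℝ)⁻¹ := by
    rw [← mul_inv, Real.mul_self_sqrt (Nat.cast_nonneg n)]
  rw [← this, ← inv_pow]
  ring

lemma posTrace_empOp (κ : ℝ) {n : ℕ} (z : Fin n → X × ℝ) : PosTrace (empOp H κ (inputs z)) := by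
  rw [empOp_eq_featureOp]; exact posTrace_featureOp _ _ _

lemma finiteDimensional_range_empOp (κ : ℝ) {n : ℕ} (z : Fin n → X × ℝ) :
    FiniteDimensional ℝ (LinearMap.range (empOp H κ (inputs z) : H →ₗ[ℝ] H)) := by
  rw [empOp_eq_featureOp]; exact finiteDimensional_range_sum _ _

lemma empNorm_add_le (κ s lam : ℝ) {n : ℕ} (z : Fin n → X × ℝ) (f g : H) :
    empNorm κ s lam (inputs z) (f + g) ≤
      empNorm κ s lam (inputs z) f + empNorm κ s lam (inputs z) g := by
  rw [empNorm, opPow_add (finiteDimensional_range_empOp κ z)]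
  exact norm_add_le _ _

lemma empNorm_neg (κ s lam : ℝ) {n : ℕ} (z : Fin n → X × ℝ) (f : H) :
    empNorm κ s lam (inputs z) (-f) = empNorm κ s lam (inputs z) f := by
  rw [empNorm, opPow_neg (finiteDimensional_range_empOp κ z), norm_neg, empNorm]

lemma empNorm_mono (κ : ℝ) {s lam lam' : ℝ} (hl : 0 < lam) (hll : lam ≤ lam') (hs : 0 ≤ s)
    {n : ℕ} (z : Fin n → X × ℝ) (f : H) :
    empNorm κ s lam (inputs z) f ≤ empNorm κ s lam' (inputs z) f :=
  norm_opPow_mono (posTrace_empOp κ z).pos (finiteDimensional_range_empOp κ z) hl hll hs f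

variable [MeasurableSpace X]

/-- Finite combinations of kernel sections are measurable and dense, and norm convergence implies
pointwise convergence because evaluations are continuous. -/
lemma measurable_coe_of_measurable_kernel
    (hK : Measurable fun p : X × X => reprKernel H p.1 p.2) (f : H) :
    Measurable fun x => f x := by
  have hf : f ∈ (Submodule.span ℝ {RKHS.kerFun H x v | (x : X) (v : ℝ)}).topologicalClosure := by
    rw [RKHS.kerFun_dense]; trivial
  obtain ⟨g, hg, hlim⟩ := mem_closure_iff_seq_limit.1 hf
  refine measurable_of_tendsto_metrizable (f := fun k x => g k x) (fun k => ?_) ?_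
  · refine Submodule.span_induction (p := fun (h : H) _ => Measurable fun x => h x)
      ?_ ?_ ?_ ?_ (hg k)
    · rintro _ ⟨y, v, rfl⟩
      simp_rw [RKHS.kerFun_apply]
      have h1 : ∀ x, RKHS.kernel H x y v = v * reprKernel H x y := fun x => by
        rw [reprKernel, ← smul_eq_mul, ← map_smul, smul_eq_mul, mul_one]
      simp_rw [h1]
      exact (hK.comp (measurable_id.prodMk measurable_const)).const_mul v
    · simp only [RKHS.coe_zero]; exact measurable_const
    · intro a b _ _ ha hb
      simpa only [RKHS.coe_add] using ha.add hb
    · intro c a _ ha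
      simpa only [RKHS.coe_smul] using ha.const_smul c
  · exact tendsto_pi_nhds.2 fun x => ((RKHS.continuous_eval x).tendsto f).comp hlim

/-- In the basis expansion of `kerSec H x` the coefficients are the values of the basis functions at
`x`, and the sum is countable. -/
lemma stronglyMeasurable_kerSec [TopologicalSpace.SeparableSpace H]
    (hK : Measurable fun p : X × X => reprKernel H p.1 p.2) :
    StronglyMeasurable fun x : X => kerSec H x := by
  borelize H
  have : SecondCountableTopology H := UniformSpace.secondCountable_of_separable H
  refine Measurable.stronglyMeasurable ?_
  have h : (fun x : X => kerSec H x) =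
      fun x => ∑' i, (traceBasis H i : H) x • traceBasis H i := by
    ext1 x
    rw [← ((traceBasis H).hasSum_repr (kerSec H x)).tsum_eq]
    refine tsum_congr fun i => ?_
    rw [HilbertBasis.repr_apply_apply, inner_kerSec]
  rw [h]
  exact Measurable.tsum fun i => (measurable_coe_of_measurable_kernel hK _).smul_const _

lemma inner_covOp [TopologicalSpace.SeparableSpace H]
    (hK : Measurable fun p : X × X => reprKernel H p.1 p.2) {κ : ℝ} (hκ : 0 < κ)
    (hKκ : ∀ x : X, reprKernel H x x ≤ κ ^ 2) (ν : Measure X) [IsFiniteMeasure ν] (v w : H) :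
    inner ℝ v (covOp H κ ν w) =
      (κ ^ 2)⁻¹ * ∫ x, inner ℝ v (kerSec H x) * inner ℝ (kerSec H x) w ∂ν := by
  have hm := stronglyMeasurable_kerSec (H := H) hK
  -- Without integrability the Bochner integral in `covOp` would be 0 by default.
  have hint : Integrable (fun x : X => pointOp H x) ν := by
    refine Integrable.of_bound (StronglyMeasurable.aestronglyMeasurable ?_) (κ ^ 2)
      (Eventually.of_forall fun x => ?_)
    · have hc : Continuous fun v : H => InnerProductSpace.rankOne ℝ v v :=
        (InnerProductSpace.rankOne ℝ).continuous.clm_apply continuous_id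
      exact hc.comp_stronglyMeasurable hm
    · rw [pointOp, InnerProductSpace.norm_rankOne, sq]
      have := norm_kerSec_le hκ hKκ x
      gcongr
  rw [covOp, _root_.smul_apply, inner_smul_right, ContinuousLinearMap.integral_apply hint,
    ← integral_inner (hint.apply_continuousLinearMap w)]
  simp_rw [pointOp, InnerProductSpace.inner_right_rankOne_apply]

lemma isCovariance_covOp [TopologicalSpace.SeparableSpace H]
    (hK : Measurable fun p : X × X => reprKernel H p.1 p.2) {κ : ℝ} (hκ : 0 < κ)
    (hKκ : ∀ x : X, reprKernel H x x ≤ κ ^ 2) (ρ : ProbabilityMeasure (X × ℝ)) :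
    IsCovariance (ρ : Measure (X × ℝ)) (feature H κ) (covOp H κ (marginal ρ)) := by
  have hm := stronglyMeasurable_kerSec (H := H) hK
  have : IsProbabilityMeasure (marginal ρ) :=
    Measure.isProbabilityMeasure_map measurable_fst.aemeasurable
  have hi := inner_covOp hK hκ hKκ (marginal ρ)
  refine ⟨?_, ?_, norm_feature_le hκ hKκ, fun v => ?_⟩
  · rw [ContinuousLinearMap.isPositive_iff]
    refine ⟨fun v w => ?_, fun v => ?_⟩
    · rw [real_inner_comm]
      simp only [ContinuousLinearMap.coe_coe]
      rw [hi, hi]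
      congr 1
      refine integral_congr_ae (Eventually.of_forall fun x => ?_)
      simp only [real_inner_comm (kerSec H x)]
      ring
    · rw [real_inner_comm, hi]
      refine mul_nonneg (by positivity) (integral_nonneg fun x => ?_)
      simp only [Pi.zero_apply]
      rw [real_inner_comm]
      exact mul_self_nonneg _
  · exact (hm.comp_measurable measurable_fst).const_smul κ⁻¹
  · rw [hi, marginal, integral_map measurable_fst.aemeasurable, ← integral_const_mul]
    · refine integral_congr_ae (Eventually.of_forall fun p => ?_)
      simp only [feature, inner_smul_left, conj_trivial, real_inner_comm (kerSec H p.1) v]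
      rw [← inv_pow]
      ring
    · exact ((stronglyMeasurable_const.inner hm).mul
        (hm.inner stronglyMeasurable_const)).aestronglyMeasurable

end Kernel

end

/-! ### Comparison and monotonicity of the sample term -/

section SampleTerm

lemma sampleTerm_le_five_mul {σ M N N' lam : ℝ} {n : ℕ} (hσ : 0 ≤ σ) (hM : 0 ≤ M)
    (hl : 0 < lam) (h : max N 1 ≤ 25 * max N' 1) :
    sampleTerm σ M n N lam ≤ 5 * sampleTerm σ M n N' lam := by
  have h1 : √(max N 1 / (n * lam)) ≤ 5 * √(max N' 1 / (n * lam)) := by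
    have h5 : (5 : ℝ) = √25 := by
      rw [show (25 : ℝ) = 5 ^ 2 by norm_num, Real.sqrt_sq (by norm_num)]
    rw [h5, ← Real.sqrt_mul (by norm_num)]
    apply Real.sqrt_le_sqrt
    rw [← mul_div_assoc]
    gcongr
  have h2 : 0 ≤ M / (n * lam) := by positivity
  have h3 := mul_le_mul_of_nonneg_left h1 hσ
  rw [sampleTerm, sampleTerm]
  linarith

/-- `lam ↦ lam ^ s * sampleTerm` is decreasing for `s ≤ 1 / 2`. -/
lemma rpow_mul_sampleTerm_anti {σ M N N' lam lam' s : ℝ} {n : ℕ} (hσ : 0 ≤ σ) (hM : 0 ≤ M)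
    (hl : 0 < lam) (hll : lam ≤ lam') (hN : N' ≤ N) (hs : s ≤ 1 / 2) :
    lam' ^ s * sampleTerm σ M n N' lam' ≤ lam ^ s * sampleTerm σ M n N lam := by
  have hl' := hl.trans_le hll
  -- The exponents are `s - 1 / 2` and `s - 1`; the restriction `s ≤ 1 / 2` makes both nonpositive.
  have key : ∀ {x : ℝ} {y : ℝ}, 0 < x → x ^ s * sampleTerm σ M n y x =
      σ * √(max y 1 / n) * x ^ (s - 1 / 2) + M / n * x ^ (s - 1) := by
    intro x y hx
    rw [sampleTerm, ← div_div, Real.sqrt_div (by positivity), Real.rpow_sub hx, Real.rpow_sub hx,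
      Real.rpow_one, Real.sqrt_eq_rpow x]
    field_simp
  rw [key hl, key hl']
  have h1 := Real.rpow_le_rpow_of_nonpos hl hll (show s - 1 / 2 ≤ 0 by linarith)
  have h2 := Real.rpow_le_rpow_of_nonpos hl hll (show s - 1 ≤ 0 by linarith)
  gcongr

lemma sampleTerm_anti {σ M N N' lam lam' : ℝ} {n : ℕ} (hσ : 0 ≤ σ) (hM : 0 ≤ M)
    (hl : 0 < lam) (hll : lam ≤ lam') (hN : N' ≤ N) :
    sampleTerm σ M n N' lam' ≤ sampleTerm σ M n N lam := by
  simpa using rpow_mul_sampleTerm_anti (n := n) (s := 0) hσ hM hl hll hN (by norm_num)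

end SampleTerm

/-! ### The balancing principle and its good event -/

section Balancing

variable {X : Type*} [MeasurableSpace X] {H : Type*} [NormedAddCommGroup H]
  [InnerProductSpace ℝ H] [CompleteSpace H] [RKHS ℝ H X ℝ]

lemma confConst_nonneg {Cs η : ℝ} (hCs : 0 ≤ Cs) (m : ℕ) : 0 ≤ confConst Cs m η :=
  mul_nonneg hCs (sq_nonneg _)

/-- The balancing principle on the event where the error decomposition holds and the empirical
and the population sample terms are comparable. -/
lemma empNorm_lamHat_le {κ σ M C Cs s η : ℝ} {A : ℝ → ℝ} {n m : ℕ} {grid : Fin (m + 1) → ℝ}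
    {est : ℝ → (Fin n → X × ℝ) → H} {ρ : ProbabilityMeasure (X × ℝ)} {f : H}
    {z : Fin n → X × ℝ} {lamStar : ℝ} (hpos : ∀ lam ∈ Set.range grid, 0 < lam)
    (hs : s ∈ Set.Icc (0 : ℝ) (1 / 2)) (hCs : 0 < Cs) (hσ : 0 ≤ σ) (hM : 0 ≤ M)
    (hA : MonotoneOn A (Set.Ioi 0)) (hcov : PosTrace (covOp H κ (marginal ρ)))
    (hstar : lamStar ∈ goodGrid H κ σ M C A n grid ρ)
    (herr : ∀ lam ∈ Set.range grid, empNorm κ s lam (inputs z) (f - est lam z) ≤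
      confConst Cs m (η / 2) * lam ^ s * (approxTerm A C n lam + popSample H κ σ M n ρ lam))
    (hcomp : ∀ lam ∈ Set.range grid,
      popSample H κ σ M n ρ lam ≤ 5 * empSample H κ σ M (inputs z) lam ∧
      empSample H κ σ M (inputs z) lam ≤ 5 * popSample H κ σ M n ρ lam) :
    empNorm κ s lamStar (inputs z) (est (lamHat κ σ M Cs s η grid est z) z - f) ≤
      102 * confConst Cs m (η / 2) * lamStar ^ s * popSample H κ σ M n ρ lamStar := by
  obtain ⟨hmem, hgood⟩ := hstar
  have hc := confConst_nonneg (η := η / 2) hCs.le m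
  set c := confConst Cs m (η / 2) with hc_def
  have hl := hpos _ hmem
  -- Below `lamStar` the approximation term can only shrink and the sample term only grow, so
  -- domination persists and the sum is at most twice the sample term.
  have herr' : ∀ lam ∈ Set.range grid, lam ≤ lamStar →
      empNorm κ s lam (inputs z) (est lam z - f) ≤
        2 * c * (lam ^ s * popSample H κ σ M n ρ lam) := by
    intro lam hlam hle
    have h1 : approxTerm A C n lam ≤ popSample H κ σ M n ρ lam := by
      calc approxTerm A C n lam ≤ approxTerm A C n lamStar :=
            add_le_add_left (hA (hpos _ hlam) hl hle) _
        _ ≤ popSample H κ σ M n ρ lamStar := hgood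
        _ ≤ popSample H κ σ M n ρ lam :=
            sampleTerm_anti hσ hM (hpos _ hlam) hle (effDim_anti hcov (hpos _ hlam) hle)
    rw [← neg_sub, empNorm_neg]
    refine (herr lam hlam).trans ?_
    have h2 : 0 ≤ c * lam ^ s := mul_nonneg hc (Real.rpow_nonneg (hpos _ hlam).le _)
    nlinarith
  -- The two errors contribute `2 + 2`, and passing to the empirical sample term multiplies by 5;
  -- this is the 20 of the selection rule.
  have hstar_mem : lamStar ∈ balancingSet κ σ M Cs s η grid est z := by
    refine ⟨hmem, fun lam hlam hle => ?_⟩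
    have h1 := empNorm_add_le κ s lam z (est lamStar z - f) (-(est lam z - f))
    rw [empNorm_neg, show est lamStar z - f + -(est lam z - f) = est lamStar z - est lam z by
      abel] at h1
    have h2 := empNorm_mono κ (hpos _ hlam) hle hs.1 z (est lamStar z - f)
    have h3 := herr' lamStar hmem le_rfl
    have h4 := herr' lam hlam hle
    have h5 : lamStar ^ s * popSample H κ σ M n ρ lamStar ≤
        lam ^ s * popSample H κ σ M n ρ lam :=
      rpow_mul_sampleTerm_anti hσ hM (hpos _ hlam) hle (effDim_anti hcov (hpos _ hlam) hle) hs.2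
    have h6 := mul_le_mul_of_nonneg_left h5 (show 0 ≤ 2 * c by linarith)
    have h7 := mul_le_mul_of_nonneg_left (hcomp lam hlam).1
      (mul_nonneg hc (Real.rpow_nonneg (hpos _ hlam).le s))
    rw [← hc_def]
    linarith
  have hfin : (balancingSet κ σ M Cs s η grid est z).Finite :=
    (Set.finite_range grid).subset fun _ h => h.1
  have hhat := Set.Nonempty.csSup_mem ⟨_, hstar_mem⟩ hfin
  have hle := le_csSup hfin.bddAbove hstar_mem
  rw [lamHat]
  -- Maximality gives `lamStar ≤ lamHat`, so admissibility of `lamHat` may be tested at `lamStar`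
  -- itself.
  have h1 := hhat.2 lamStar hmem hle
  rw [← hc_def] at h1
  set lamH := sSup (balancingSet κ σ M Cs s η grid est z)
  have h2 := empNorm_add_le κ s lamStar z (est lamH z - est lamStar z) (est lamStar z - f)
  rw [sub_add_sub_cancel] at h2
  have h3 := herr' lamStar hmem le_rfl
  have h4 := mul_le_mul_of_nonneg_left (hcomp lamStar hmem).2
    (mul_nonneg hc (Real.rpow_nonneg hl.le s))
  linarith

variable [TopologicalSpace.SeparableSpace H]

/-- The population and empirical effective dimensions at one regularization parameter are
comparable with high probability. -/
lemma measure_not_comparable_le (hK : Measurable fun p : X × X => reprKernel H p.1 p.2)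
    {κ : ℝ} (hκ : 0 < κ) (hKκ : ∀ x : X, reprKernel H x x ≤ κ ^ 2)
    (ρ : ProbabilityMeasure (X × ℝ)) {n : ℕ} {lam₀ lam : ℝ} (hl₀ : 0 < lam₀)
    (hn : 2 ≤ n * lam₀) (hll : lam₀ ≤ lam) :
    sampleLaw n ρ {z | ¬ (max (popDim H κ ρ lam) 1 ≤
        25 * max (effDim (empOp H κ (inputs z)) lam) 1 ∧
      max (effDim (empOp H κ (inputs z)) lam) 1 ≤ 25 * max (popDim H κ ρ lam) 1)} ≤
      2 * ENNReal.ofReal (Real.exp (-(1 / 2) * √(popDim H κ ρ lam₀))) := by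
  have hT := isCovariance_covOp hK hκ hKκ ρ
  have hl := hl₀.trans_le hll
  have hnl : n * lam₀ ≤ n * lam := by gcongr
  have hlow := measure_effDim_featureOp_le hT (hn.trans hnl) hl
  have hupp := measure_le_effDim_featureOp hT (hn.trans hnl) hl
  have hmono := mul_effDim_mono hT.posTrace hl₀ hll
  have hanti := effDim_anti hT.posTrace hl₀ hll
  have hN0 := effDim_nonneg hT.pos hl₀
  simp_rw [← empOp_eq_featureOp] at hlow hupp
  change _ ≤ 2 * ENNReal.ofReal (Real.exp (-(1 / 2) * √(effDim (covOp H κ (marginal ρ)) lam₀)))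
  simp only [popDim]
  set N := effDim (covOp H κ (marginal ρ)) lam
  set N₀ := effDim (covOp H κ (marginal ρ)) lam₀
  -- Since `lam * N(lam)` increases, the exponents of both tails are controlled by `N₀` at the
  -- smallest grid point.
  have hprod : 2 * N₀ ≤ n * lam * N := by
    have : n * (lam₀ * N₀) ≤ n * (lam * N) := by gcongr
    nlinarith
  have hsqrt : √N₀ ≤ 1 + N₀ := by
    rw [Real.sqrt_le_left (by linarith)]; nlinarith
  have hU : sampleLaw n ρ {z | 25 * max N 1 ≤ effDim (empOp H κ (inputs z)) lam} ≤
      ENNReal.ofReal (Real.exp (-(1 / 2) * √N₀)) := by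
    refine hupp.trans (ENNReal.ofReal_le_ofReal (Real.exp_le_exp.2 ?_))
    have h1 : n * lam * N ≤ n * lam * max N 1 :=
      mul_le_mul_of_nonneg_left (le_max_left _ _) (by linarith)
    have h2 : n * lam * 1 ≤ n * lam * max N 1 :=
      mul_le_mul_of_nonneg_left (le_max_right _ _) (by linarith)
    linarith
  -- If `N ≤ 25` the comparison cannot fail on this side, because of the maximum with 1. Otherwise
  -- `N₀ ≥ N > 25`, and then `4 / 5 * N₀` exceeds `(1 + N₀) / 2`.
  have hL : sampleLaw n ρ {z | 25 < N ∧ 25 * effDim (empOp H κ (inputs z)) lam ≤ N} ≤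
      ENNReal.ofReal (Real.exp (-(1 / 2) * √N₀)) := by
    by_cases h25 : 25 < N
    · refine (measure_mono fun z hz => hz.2).trans
        (hlow.trans (ENNReal.ofReal_le_ofReal (Real.exp_le_exp.2 ?_)))
      linarith
    · simp [h25]
  refine (measure_mono fun z hz => ?_).trans ((measure_union_le _ _).trans
    ((add_le_add hL hU).trans (two_mul _).ge))
  simp only [Set.mem_ofPred_eq, not_and_or, not_le] at hz
  simp only [Set.mem_union, Set.mem_ofPred_eq]
  rcases hz with hz | hz
  · left
    have h1 := le_max_left (effDim (empOp H κ (inputs z)) lam) 1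
    have h2 := le_max_right (effDim (empOp H κ (inputs z)) lam) 1
    rcases lt_max_iff.1 hz with h | h
    · exact ⟨by linarith, by linarith⟩
    · linarith
  · right
    have h1 := le_max_right N 1
    rcases lt_max_iff.1 hz with h | h
    · exact h.le
    · linarith

end Balancing

end LepskiiBalancing

/-! ### Union bound over the grid -/

theorem mainTheorem7
    {X : Type*} [MeasurableSpace X] [StandardBorelSpace X]
    {H : Type*} [NormedAddCommGroup H] [InnerProductSpace ℝ H] [CompleteSpace H]
    [TopologicalSpace.SeparableSpace H] [RKHS ℝ H X ℝ]
    (hK : Measurable fun p : X × X => reprKernel H p.1 p.2)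
    (κ : ℝ) (hκ : 0 < κ) (hKκ : ∀ x : X, reprKernel H x x ≤ κ ^ 2)
    (models : Set (ProbabilityMeasure (X × ℝ)))
    (freg : ProbabilityMeasure (X × ℝ) → H)
    (hfreg : ∀ ρ ∈ models, IsRegressionFunction (ρ : Measure (X × ℝ)) (freg ρ))
    (n m : ℕ) (grid : Fin (m + 1) → ℝ) (est : ℝ → (Fin n → X × ℝ) → H)
    (σ M C Cs s : ℝ) (A : ℝ → ℝ) (η : ℝ) (hη : η ∈ Set.Ioc (0 : ℝ) 1)
    (hdecomp : ErrorDecomposition models freg est grid κ σ M C Cs s A (η / 2))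
    (hn : 2 ≤ (n : ℝ) * grid 0)
    (ρ : ProbabilityMeasure (X × ℝ)) (hρ : ρ ∈ models)
    (hηn : etaMin H κ grid ρ ≤ η)
    (lamStar : ℝ) (hlamStar : IsGreatest (goodGrid H κ σ M C A n grid ρ) lamStar) :
    HoldsWithProb (sampleLaw n ρ) η fun z =>
      empNorm κ s lamStar (inputs z)
          (est (lamHat κ σ M Cs s η grid est z) z - freg ρ)
        ≤ 102 * confConst Cs m (η / 2) * lamStar ^ s * popSample H κ σ M n ρ lamStar := by
  have hprob : IsProbabilityMeasure (sampleLaw n ρ) := by unfold sampleLaw; infer_instance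
  -- When the minimum in `etaMin` is 1, the claim only bounds a probability by a number at least 1.
  by_cases htriv : 1 ≤ 4 * ((m : ℝ) + 1) *
      Real.exp (-(1 / 2) * Real.sqrt (popDim H κ ρ (grid 0)))
  · rw [etaMin, min_eq_left htriv] at hηn
    exact prob_le_one.trans (by simpa using hηn)
  rw [etaMin, min_eq_right (not_le.1 htriv).le] at hηn
  have hmin : ∀ i, grid 0 ≤ grid i := fun i => hdecomp.grid_strictMono.monotone (Fin.zero_le i)
  have hpos : ∀ lam ∈ Set.range grid, 0 < lam := by
    rintro _ ⟨i, rfl⟩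
    exact hdecomp.grid_pos.trans_le (hmin i)
  have hT := isCovariance_covOp hK hκ hKκ ρ
  have hcmp := fun i => measure_not_comparable_le hK hκ hKκ ρ hdecomp.grid_pos hn (hmin i)
  set q := Real.exp (-(1 / 2) * Real.sqrt (popDim H κ ρ (grid 0))) with hq
  have hq0 : 0 < q := Real.exp_pos _
  have hunion := (measure_iUnion_fintype_le (sampleLaw n ρ) _).trans
    (Finset.sum_le_sum fun i _ => hcmp i)
  -- Each of the `m + 1` points costs `2 q`, and `4 (m + 1) q ≤ η`. The other `η / 2` pays for the
  -- error decomposition.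
  have hsum : ∑ _i : Fin (m + 1), 2 * ENNReal.ofReal q ≤ ENNReal.ofReal (η / 2) := by
    rw [Finset.sum_const, Finset.card_univ, Fintype.card_fin, nsmul_eq_mul,
      show (2 : ENNReal) = ENNReal.ofReal 2 by simp, ← ENNReal.ofReal_mul (by norm_num),
      ← ENNReal.ofReal_natCast, ← ENNReal.ofReal_mul (by positivity)]
    apply ENNReal.ofReal_le_ofReal
    push_cast
    linarith
  have herr := hdecomp.bound ρ hρ
  unfold HoldsWithProb at herr ⊢
  have hη2 : ENNReal.ofReal η = ENNReal.ofReal (η / 2) + ENNReal.ofReal (η / 2) := by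
    rw [← ENNReal.ofReal_add (by linarith [hη.1]) (by linarith [hη.1]), add_halves]
  rw [hη2]
  refine (measure_mono ?_).trans ((measure_union_le _ _).trans
    (add_le_add herr (hunion.trans hsum)))
  intro z hz
  by_contra hcon
  simp only [Set.mem_union, Set.mem_ofPred_eq, Set.mem_iUnion, not_or, not_not, not_exists] at hcon
  refine hz (empNorm_lamHat_le hpos hdecomp.s_mem hdecomp.Cs_pos hdecomp.sigma_nonneg
    hdecomp.M_nonneg hdecomp.A_mono hT.posTrace hlamStar.1 hcon.1 ?_)
  rintro _ ⟨i, rfl⟩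
  have hi := hpos _ ⟨i, rfl⟩
  exact ⟨sampleTerm_le_five_mul hdecomp.sigma_nonneg hdecomp.M_nonneg hi (hcon.2 i).1,
    sampleTerm_le_five_mul hdecomp.sigma_nonneg hdecomp.M_nonneg hi (hcon.2 i).2⟩
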